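/- **Setting.** Let $H$ be a commutative Banach ring and let $\mathrm{Ban}_H$ be the category of Banach $H$-modules and bounded $H$-linear maps (either all Banach modules, or, for nonarchimedean $H$, the nonarchimedean ones). Let $\mathcal E$ be $\mathrm{Ind}(\mathrm{Ban}_H)$ or $\mathrm{Ind}^m(\mathrm{Ban}_H)$ (formal filtered colimits with arbitrary, respectively monomorphic, transition maps), with the completed tensor product, and let $\mathcal{LH}$ be its left heart; it contains $\mathcal E$. Let $\mathcal C$ be the $\infty$-category of simplicial commutative algebras over $\mathcal E$, presented by simplicial commutative algebra objects of $\mathcal{LH}$. For $A \in \mathcal C$ the homotopy objects $\pi_n(A)$ are formed in $\mathcal{LH}$; $\pi_0(A)$ is a commutative algebra and $\pi_n(A)$ is a $\pi_0(A)$-module. An affine stack $X = \mathrm{Spec}\,B$ is an object of $\mathcal C^{\mathrm{op}}$, with functor of points $X(R) = \mathrm{Map}_{\mathcal C}(B, R)$ with values in simplicial sets. Commutative algebra objects of $\mathcal{LH}$, such as the quotients $\pi_0(R)/I$ by ideals $I$, are regarded as discrete objects of $\mathcal C$. **Definitions.** Let $f : X = \mathrm{Spec}\,B \to Y = \mathrm{Spec}\,A$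 be a morphism, given by $A \to B$. * $f$ is *affinoid* if for some $d$ there is a surjection $\pi_0(A)\langle X_1, \dots, X_d\rangle \to \pi_0(B)$ of $\pi_0(A)$-algebras, and $\pi_0(B) \otimes_{\pi_0(A)} \pi_n(A) \to \pi_n(B)$ is an isomorphism for every $n \ge 0$. * The *formal completion* $Y_{X,\mathrm{dR}}$ and the *PD completion* $Y_{X,\mathrm{crys}}$ are the functors $$Y_{X,\mathrm{dR}}(R) = \varinjlim_{I} X(\pi_0(R)/I) \times_{Y(\pi_0(R)/I)} Y(R), \qquad Y_{X,\mathrm{crys}}(R) = \varinjlim_{(I,\gamma)} X(\pi_0(R)/I) \times_{Y(\pi_0(R)/I)} Y(R),$$ with homotopy fibre products, where $I$ runs through all nilpotent ideals of $\pi_0(R)$ (not necessarily closed), ordered by inclusion, and $(I,\gamma)$ through all nilpotent ideals of $\pi_0(R)$ together with a divided power structure $\gamma$, ordered by inclusions compatible with the divided powers. There are canonical maps from $X(R)$ to both, through the index $I = 0$. * $f$ is *de Rham intrinsic étale* if it is affinoid and $\pi_0(X(R)) \to \pi_0(Y_{X,\mathrm{dR}}(R))$ is a bijection for every $R \in \mathcal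 C$. It is *PD intrinsic étale* if it is affinoid and $\pi_0(X(R)) \to \pi_0(Y_{X,\mathrm{crys}}(R))$ is a bijection for every $R \in \mathcal C$. **Proposition.** Let $f : X \to Y$ and $g : Y \to Z$ be de Rham intrinsic étale morphisms of affine stacks. Then $g \circ f$ is de Rham intrinsic étale, and it is also PD intrinsic étale. -/

import Mathlib

open CategoryTheory Opposite
open scoped ENNReal Topology

universe u

namespace AnalyticStack

/-- The two standard conventions for Banach modules over a commutative Banach ring `H`: all Banach
modules, or (for `H` nonarchimedean) the nonarchimedean ones. -/
inductive BanachKind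
  | general
  | nonarchimedean

/-- The condition that the convention imposes on a normed object. -/
def BanachKind.Admits : BanachKind → ∀ (V : Type u) [Dist V], Prop
  | .general, _, _ => True
  | .nonarchimedean, V, _ => IsUltrametricDist V

/-- Free Banach modules are of type `ℓ¹` in the general and of type `c₀` in the nonarchimedean
convention. -/
def BanachKind.exponent : BanachKind → ℝ≥0∞
  | .general => 1
  | .nonarchimedean => ⊤

/-- `H` is a commutative Banach ring admitted by the convention `k`. -/
class BanachBase (k : BanachKind) (H : Type u) [NormedCommRing H] : Prop where
  complete : CompleteSpace H
  admits : k.Admits H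

/-- A Banach module over `H`. -/
structure BanachModule (k : BanachKind) (H : Type u) [NormedCommRing H] where
  carrier : Type u
  [normed : NormedAddCommGroup carrier]
  [module : Module H carrier]
  [bounded : IsBoundedSMul H carrier]
  [complete : CompleteSpace carrier]
  admits : k.Admits carrier

attribute [instance] BanachModule.normed BanachModule.module BanachModule.bounded
  BanachModule.complete

/-- The `H`-module of bounded `H`-linear maps. -/
def BoundedHom {k : BanachKind} {H : Type u} [NormedCommRing H] (V W : BanachModule k H) :
    Submodule H (V.carrier →ₗ[H] W.carrier) where
  carrier := {f | ∃ C : ℝ, ∀ x, ‖f x‖ ≤ C * ‖x‖}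
  zero_mem' := ⟨0, fun x => by simp⟩
  add_mem' := by
    rintro f g ⟨C, hC⟩ ⟨D, hD⟩
    exact ⟨C + D, fun x => (norm_add_le _ _).trans (by rw [add_mul]; exact add_le_add (hC x) (hD x))⟩
  smul_mem' := by
    rintro h f ⟨C, hC⟩
    refine ⟨‖h‖ * C, fun x => (norm_smul_le h (f x)).trans ?_⟩
    rw [mul_assoc]
    exact mul_le_mul_of_nonneg_left (hC x) (norm_nonneg _)

namespace BoundedHom

variable {k : BanachKind} {H : Type u} [NormedCommRing H]

def id (V : BanachModule k H) : BoundedHom V V :=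
  ⟨LinearMap.id, 1, fun x => by simp⟩

def comp {U V W : BanachModule k H} (g : BoundedHom V W) (f : BoundedHom U V) :
    BoundedHom U W :=
  ⟨g.1 ∘ₗ f.1, by
    obtain ⟨C, hC⟩ := f.2
    obtain ⟨D, hD⟩ := g.2
    refine ⟨|D| * C, fun x => (hD _).trans ?_⟩
    rw [mul_assoc]
    exact (mul_le_mul_of_nonneg_right (le_abs_self D) (norm_nonneg _)).trans
      (mul_le_mul_of_nonneg_left (hC x) (abs_nonneg D))⟩

end BoundedHom

/-- The category `Ban_H`. -/
instance {k : BanachKind} {H : Type u} [NormedCommRing H] : Category (BanachModule k H) where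
  Hom V W := BoundedHom V W
  id V := BoundedHom.id V
  comp f g := BoundedHom.comp g f

/-- A normed set (the base point, which has norm zero, is left out): a set with positive weights. -/
structure NormedSet : Type (u + 1) where
  carrier : Type u
  weight : carrier → {r : ℝ // 0 < r}

/-- The module `H` with its norm multiplied by `r`. -/
def ScaledLine (H : Type u) (_r : {r : ℝ // 0 < r}) : Type u := H

namespace ScaledLine

variable {H : Type u} [NormedCommRing H] (r : {r : ℝ // 0 < r})

instance : AddCommGroup (ScaledLine H r) := inferInstanceAs (AddCommGroup H)

instance : Module H (ScaledLine H r) := inferInstanceAs (Module H H)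

instance : Norm (ScaledLine H r) := ⟨fun x => r.1 * ‖(show H from x)‖⟩

theorem norm_def (x : H) : ‖(show ScaledLine H r from x)‖ = r.1 * ‖x‖ := rfl

instance : NormedAddCommGroup (ScaledLine H r) :=
  { AddGroupNorm.toNormedAddCommGroup (E := ScaledLine H r)
      { toFun := fun x => ‖x‖
        map_zero' := by
          change r.1 * ‖(0 : H)‖ = 0
          simp
        add_le' := fun x y => by
          change r.1 * ‖(show H from x) + (show H from y)‖ ≤
            r.1 * ‖(show H from x)‖ + r.1 * ‖(show H from y)‖
          rw [← mul_add]
          exact mul_le_mul_of_nonneg_left (norm_add_le _ _) r.2.le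
        neg' := fun x => by
          change r.1 * ‖-(show H from x)‖ = r.1 * ‖(show H from x)‖
          rw [norm_neg]
        eq_zero_of_map_eq_zero' := fun x hx => by
          have h : r.1 * ‖(show H from x)‖ = 0 := hx
          rcases mul_eq_zero.1 h with h | h
          · exact absurd h r.2.ne'
          · exact norm_eq_zero.1 h } with }

instance : IsBoundedSMul H (ScaledLine H r) := IsBoundedSMul.of_norm_smul_le fun h x => by
  change r.1 * ‖h * (show H from x)‖ ≤ ‖h‖ * (r.1 * ‖(show H from x)‖)
  calc r.1 * ‖h * (show H from x)‖ ≤ r.1 * (‖h‖ * ‖(show H from x)‖) :=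
        mul_le_mul_of_nonneg_left (norm_mul_le _ _) r.2.le
    _ = _ := by ring

end ScaledLine

instance BanachKind.fact_exponent (k : BanachKind) : Fact (1 ≤ k.exponent) :=
  ⟨by cases k <;> simp [BanachKind.exponent]⟩

theorem ScaledLine.completeSpace {H : Type u} [NormedCommRing H] [CompleteSpace H]
    (r : {r : ℝ // 0 < r}) : CompleteSpace (ScaledLine H r) := by
  refine Metric.complete_of_cauchySeq_tendsto fun a ha => ?_
  let b : ℕ → H := a
  have key : ∀ x y : H, dist (show ScaledLine H r from x) (show ScaledLine H r from y)
      = r.1 * dist x y := fun x y => by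
    rw [dist_eq_norm, dist_eq_norm]
    rfl
  have hb : CauchySeq b := by
    rw [Metric.cauchySeq_iff] at ha ⊢
    intro ε hε
    obtain ⟨N, hN⟩ := ha (r.1 * ε) (mul_pos r.2 hε)
    refine ⟨N, fun m hm n hn => ?_⟩
    have h := hN m hm n hn
    rw [key (b m) (b n)] at h
    exact lt_of_mul_lt_mul_left h r.2.le
  obtain ⟨x, hx⟩ := cauchySeq_tendsto_of_complete hb
  refine ⟨(show ScaledLine H r from x), tendsto_iff_dist_tendsto_zero.2 ?_⟩
  rw [tendsto_iff_dist_tendsto_zero] at hx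
  have h := hx.const_mul r.1
  rw [mul_zero] at h
  exact h.congr fun n => (key (b n) x).symm

namespace NormedSet

variable (k : BanachKind) (H : Type u) [NormedCommRing H]

/-- Families `(a_s)` in `H` with `∑ ‖a_s‖ |s| < ∞`, respectively with `‖a_s‖ |s|` bounded. -/
abbrev Coefficients (S : NormedSet.{u}) : Type u :=
  lp (fun s : S.carrier => ScaledLine H (S.weight s)) k.exponent

/-- The families with `‖a_s‖ |s| → 0`; this is automatic in the `ℓ¹` case. -/
def freeSubmodule (S : NormedSet.{u}) : Submodule H (S.Coefficients k H) where
  carrier := {a | Filter.Tendsto (fun s => ‖a s‖) Filter.cofinite (𝓝 0)}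
  zero_mem' := by simpa using tendsto_const_nhds
  add_mem' {a b} ha hb := by
    have h := Filter.Tendsto.add ha hb
    rw [add_zero] at h
    exact squeeze_zero (fun s => norm_nonneg _) (fun s => norm_add_le (a s) (b s)) h
  smul_mem' c a ha := by
    have h := Filter.Tendsto.const_mul ‖c‖ ha
    rw [mul_zero] at h
    exact squeeze_zero (fun s => norm_nonneg _) (fun s => norm_smul_le c (a s)) h

theorem isClosed_freeSubmodule (S : NormedSet.{u}) :
    IsClosed (S.freeSubmodule k H : Set (S.Coefficients k H)) := by
  have hp : k.exponent ≠ 0 := by cases k <;> simp [BanachKind.exponent]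
  rw [← closure_subset_iff_isClosed]
  intro a ha
  rw [Metric.mem_closure_iff] at ha
  change Filter.Tendsto (fun s => ‖a s‖) Filter.cofinite (𝓝 0)
  rw [Metric.tendsto_nhds]
  intro ε hε
  obtain ⟨b, hb, hab⟩ := ha (ε / 2) (half_pos hε)
  filter_upwards [(Metric.tendsto_nhds.1 hb) (ε / 2) (half_pos hε)] with s hs
  have h1 : ‖a s - b s‖ < ε / 2 :=
    (lp.norm_apply_le_norm hp (a - b) s).trans_lt (by rwa [dist_eq_norm] at hab)
  simp only [dist_zero_right, norm_norm] at hs ⊢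
  calc ‖a s‖ = ‖(a s - b s) + b s‖ := by rw [sub_add_cancel]
    _ ≤ ‖a s - b s‖ + ‖b s‖ := norm_add_le _ _
    _ < ε := by linarith

variable [hb : BanachBase k H]

theorem admits_free (S : NormedSet.{u}) : k.Admits (S.freeSubmodule k H) := by
  cases k with
  | general => trivial
  | nonarchimedean =>
    have hH : IsUltrametricDist H := hb.admits
    refine IsUltrametricDist.isUltrametricDist_of_forall_norm_add_le_max_norm fun a b => ?_
    refine lp.norm_le_of_forall_le (le_max_of_le_left (norm_nonneg _)) fun s => ?_
    have h1 : ‖(a.1 + b.1) s‖ ≤ max ‖a.1 s‖ ‖b.1 s‖ := by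
      change (S.weight s).1 * ‖(show H from a.1 s) + (show H from b.1 s)‖ ≤
        max ((S.weight s).1 * ‖(show H from a.1 s)‖) ((S.weight s).1 * ‖(show H from b.1 s)‖)
      rw [← mul_max_of_nonneg _ _ (S.weight s).2.le]
      exact mul_le_mul_of_nonneg_left (IsUltrametricDist.norm_add_le_max _ _) (S.weight s).2.le
    exact h1.trans (max_le_max (lp.norm_apply_le_norm (by simp [BanachKind.exponent]) a.1 s)
      (lp.norm_apply_le_norm (by simp [BanachKind.exponent]) b.1 s))

/-- The free Banach `H`-module on a normed set, `ℓ¹(S)` or `c₀(S)`. These modules are compact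
projective generators of `Ind(Ban_H)` and of `Ind^m(Ban_H)`. -/
noncomputable def free (S : NormedSet.{u}) : BanachModule k H :=
  haveI : CompleteSpace H := hb.complete
  haveI : ∀ s, CompleteSpace (ScaledLine H (S.weight s)) := fun s => ScaledLine.completeSpace _
  haveI : CompleteSpace (S.freeSubmodule k H) :=
    (S.isClosed_freeSubmodule k H).completeSpace_coe
  haveI : IsBoundedSMul H (S.freeSubmodule k H) :=
    IsBoundedSMul.of_norm_smul_le fun c a => norm_smul_le c a.1
  { carrier := S.freeSubmodule k H
    admits := S.admits_free k H }

variable {k H}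

open Classical in
/-- The basis vector at `s`. -/
noncomputable def basis (S : NormedSet.{u}) (s : S.carrier) : (S.free k H).carrier :=
  ⟨lp.single k.exponent s (show ScaledLine H (S.weight s) from (1 : H)), by
    refine tendsto_const_nhds.congr' ?_
    have : ({s}ᶜ : Set S.carrier) ∈ Filter.cofinite := (Set.finite_singleton s).compl_mem_cofinite
    filter_upwards [this] with t ht
    rw [lp.single_apply_ne _ _ _ ht, norm_zero]⟩


/-- The coordinate at `s`. -/
noncomputable def coord (S : NormedSet.{u}) (a : (S.free k H).carrier) (s : S.carrier) : H := a.1 s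

theorem norm_basis (S : NormedSet.{u}) (s : S.carrier) :
    ‖S.basis (k := k) (H := H) s‖ = (S.weight s).1 * ‖(1 : H)‖ := by
  classical
  have hp : 0 < k.exponent := by cases k <;> simp [BanachKind.exponent]
  exact lp.norm_single (E := fun s => ScaledLine H (S.weight s)) hp s _

theorem summable_smul_and_bound (S : NormedSet.{u}) (V : BanachModule k H)
    (v : S.carrier → V.carrier) {C : ℝ} (hC : ∀ s, ‖v s‖ ≤ C * (S.weight s).1)
    (a : (S.free k H).carrier) :
    Summable (fun s => S.coord a s • v s) ∧ ‖∑' s, S.coord a s • v s‖ ≤ |C| * ‖a‖ := by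
  have hle : ∀ s, ‖S.coord a s • v s‖ ≤ |C| * ‖a.1 s‖ := fun s => by
    refine (norm_smul_le _ _).trans ?_
    change _ ≤ |C| * ((S.weight s).1 * ‖S.coord a s‖)
    calc ‖S.coord a s‖ * ‖v s‖ ≤ ‖S.coord a s‖ * (|C| * (S.weight s).1) :=
          mul_le_mul_of_nonneg_left ((hC s).trans
            (mul_le_mul_of_nonneg_right (le_abs_self C) (S.weight s).2.le)) (norm_nonneg _)
      _ = _ := by ring
  cases k with
  | general =>
    have hs := lp.hasSum_norm (p := 1) (by simp) a.1
    simp only [ENNReal.toReal_one, Real.rpow_one] at hs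
    have h2 := hs.mul_left |C|
    have h1 : Summable fun s => ‖S.coord a s • v s‖ :=
      Summable.of_nonneg_of_le (fun s => norm_nonneg _) hle h2.summable
    exact ⟨h1.of_norm, (norm_tsum_le_tsum_norm h1).trans
      ((h1.tsum_le_tsum hle h2.summable).trans h2.tsum_eq.le)⟩
  | nonarchimedean =>
    have : IsUltrametricDist V.carrier := V.admits
    constructor
    · refine NonarchimedeanAddGroup.summable_of_tendsto_cofinite_zero ?_
      have h := Filter.Tendsto.const_mul |C| a.2
      rw [mul_zero] at h
      exact squeeze_zero_norm hle h
    · refine IsUltrametricDist.norm_tsum_le_of_forall_le_of_nonneg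
        (mul_nonneg (abs_nonneg C) (norm_nonneg _)) fun s => (hle s).trans ?_
      exact mul_le_mul_of_nonneg_left
        (lp.norm_apply_le_norm (by simp [BanachKind.exponent]) a.1 s) (abs_nonneg C)

/-- The universal property of the free module: a bounded family extends to a bounded map. -/
noncomputable def lift (S : NormedSet.{u}) {V : BanachModule k H} (v : S.carrier → V.carrier)
    (hv : ∃ C : ℝ, ∀ s, ‖v s‖ ≤ C * (S.weight s).1) : BoundedHom (S.free k H) V :=
  ⟨{ toFun := fun a => ∑' s, S.coord a s • v s
     map_add' := fun a b => by
      obtain ⟨C, hC⟩ := hv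
      rw [← (S.summable_smul_and_bound V v hC a).1.tsum_add
        (S.summable_smul_and_bound V v hC b).1]
      exact tsum_congr fun s => add_smul (S.coord a s) (S.coord b s) (v s)
     map_smul' := fun c a => by
      obtain ⟨C, hC⟩ := hv
      rw [RingHom.id_apply, ← (S.summable_smul_and_bound V v hC a).1.tsum_const_smul c]
      exact tsum_congr fun s => mul_smul c (S.coord a s) (v s) }, by
    obtain ⟨C, hC⟩ := hv
    exact ⟨|C|, fun a => (S.summable_smul_and_bound V v hC a).2⟩⟩

theorem lift_basis (S : NormedSet.{u}) {V : BanachModule k H} (v : S.carrier → V.carrier)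
    (hv : ∃ C : ℝ, ∀ s, ‖v s‖ ≤ C * (S.weight s).1) (s : S.carrier) :
    (S.lift v hv).1 (S.basis s) = v s := by
  classical
  change ∑' t, S.coord (S.basis s) t • v t = v s
  rw [tsum_eq_single s]
  · have : S.coord (S.basis (k := k) (H := H) s) s = 1 :=
      lp.single_apply_self (E := fun s => ScaledLine H (S.weight s)) k.exponent s _
    rw [this, one_smul]
  · intro t ht
    have : S.coord (S.basis (k := k) (H := H) s) t = 0 :=
      lp.single_apply_ne (E := fun s => ScaledLine H (S.weight s)) k.exponent s _ ht
    rw [this, zero_smul]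

end NormedSet

theorem BoundedHom.continuous {k : BanachKind} {H : Type u} [NormedCommRing H]
    {V W : BanachModule k H} (f : BoundedHom V W) : Continuous f.1 := by
  obtain ⟨C, hC⟩ := f.2
  exact AddMonoidHomClass.continuous_of_bound f.1 C hC

theorem BoundedHom.comp_apply {k : BanachKind} {H : Type u} [NormedCommRing H]
    {U V W : BanachModule k H} (g : BoundedHom V W) (f : BoundedHom U V) (x : U.carrier) :
    (BoundedHom.comp g f).1 x = g.1 (f.1 x) := rfl

theorem BoundedHom.id_apply {k : BanachKind} {H : Type u} [NormedCommRing H]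
    {V : BanachModule k H} (x : V.carrier) : (BoundedHom.id V).1 x = x := rfl

namespace NormedSet

variable {k : BanachKind} {H : Type u} [NormedCommRing H] [BanachBase k H]

theorem coord_basis_self (S : NormedSet.{u}) (s : S.carrier) :
    S.coord (S.basis (k := k) (H := H) s) s = 1 := by
  classical
  exact lp.single_apply_self (E := fun s => ScaledLine H (S.weight s)) k.exponent s _

theorem coord_basis_ne (S : NormedSet.{u}) {s t : S.carrier} (h : t ≠ s) :
    S.coord (S.basis (k := k) (H := H) s) t = 0 := by
  classical
  exact lp.single_apply_ne (E := fun s => ScaledLine H (S.weight s)) k.exponent s _ h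

theorem hasSum_basis (S : NormedSet.{u}) (a : (S.free k H).carrier) :
    HasSum (fun s => S.coord a s • S.basis s) a := by
  have hs := (S.summable_smul_and_bound (S.free k H) S.basis (C := ‖(1 : H)‖)
    (fun s => by rw [norm_basis, _root_.mul_comm]) a).1
  have hp : k.exponent ≠ 0 := by cases k <;> simp [BanachKind.exponent]
  obtain ⟨b, hb⟩ := hs
  suffices hba : b = a by rwa [hba] at hb
  refine Subtype.ext (lp.ext (funext fun t => ?_))
  let e : (S.free k H).carrier →+ ScaledLine H (S.weight t) :=
    { toFun := fun a => a.1 t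
      map_zero' := rfl
      map_add' := fun _ _ => rfl }
  have he : Continuous e := AddMonoidHomClass.continuous_of_bound e 1 fun a => by
    rw [_root_.one_mul]
    exact lp.norm_apply_le_norm hp a.1 t
  have h1 := hb.map e he
  refine h1.unique ?_
  have h2 : e a = (e ∘ fun s => S.coord a s • S.basis s) t := by
    change S.coord a t = S.coord a t * S.coord (S.basis (k := k) t) t
    rw [coord_basis_self, _root_.mul_one]
  change HasSum _ (e a)
  rw [h2]
  refine hasSum_single t fun s hst => ?_
  change S.coord a s * S.coord (S.basis (k := k) s) t = 0
  rw [S.coord_basis_ne hst.symm, mul_zero]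

theorem hom_ext {S : NormedSet.{u}} {V : BanachModule k H} {f g : BoundedHom (S.free k H) V}
    (h : ∀ s, f.1 (S.basis s) = g.1 (S.basis s)) : f = g := by
  refine Subtype.ext (LinearMap.ext fun a => ?_)
  have hf := (S.hasSum_basis a).map f.1 (BoundedHom.continuous f)
  have hg := (S.hasSum_basis a).map g.1 (BoundedHom.continuous g)
  refine hf.unique ?_
  have hfg : (f.1 ∘ fun s => S.coord a s • S.basis s) = g.1 ∘ fun s => S.coord a s • S.basis s := by
    funext s
    change f.1 (S.coord a s • S.basis s) = g.1 (S.coord a s • S.basis s)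
    rw [map_smul, map_smul, h]
  rwa [hfg]

/-- Product of normed sets. The completed tensor product of the free modules on `S` and `T` is the
free module on `S.tensor T`. -/
abbrev tensor (S T : NormedSet.{u}) : NormedSet.{u} where
  carrier := S.carrier × T.carrier
  weight p := ⟨(S.weight p.1).1 * (T.weight p.2).1, mul_pos (S.weight p.1).2 (T.weight p.2).2⟩

/-- The unit: its free module is `H`. -/
abbrev point : NormedSet.{u} where
  carrier := PUnit
  weight _ := ⟨1, one_pos⟩

/-- The monomials in `d` variables, all of norm one. The free module is the Tate algebra
`H⟨X_1, …, X_d⟩` (in the general convention the disc algebra, with `ℓ¹` coefficients). -/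
abbrev monomials (d : ℕ) : NormedSet.{u} where
  carrier := ULift.{u} (Fin d → ℕ)
  weight _ := ⟨1, one_pos⟩

variable (k H) in
noncomputable def push {S T : NormedSet.{u}} (φ : S.carrier → T.carrier)
    (hφ : ∀ s, (T.weight (φ s)).1 ≤ (S.weight s).1) : BoundedHom (S.free k H) (T.free k H) :=
  S.lift (fun s => T.basis (φ s)) ⟨‖(1 : H)‖, fun s => by
    rw [norm_basis, mul_comm]
    exact mul_le_mul_of_nonneg_left (hφ s) (norm_nonneg _)⟩

noncomputable def basisMul (S T : NormedSet.{u}) (s : S.carrier) :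
    BoundedHom (T.free k H) ((S.tensor T).free k H) :=
  T.lift (fun t => (S.tensor T).basis (s, t)) ⟨(S.weight s).1 * ‖(1 : H)‖, fun t => by
    rw [norm_basis]
    change (S.weight s).1 * (T.weight t).1 * _ ≤ _
    exact le_of_eq (by ring)⟩

theorem norm_basisMul_le (S T : NormedSet.{u}) (s : S.carrier) (b : (T.free k H).carrier) :
    ‖(S.basisMul T s).1 b‖ ≤ ‖(1 : H)‖ * ‖b‖ * (S.weight s).1 := by
  have h := (T.summable_smul_and_bound ((S.tensor T).free k H)
    (fun t => (S.tensor T).basis (s, t)) (C := (S.weight s).1 * ‖(1 : H)‖) (fun t => by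
      rw [norm_basis]
      change (S.weight s).1 * (T.weight t).1 * _ ≤ _
      exact le_of_eq (by ring)) b).2
  rw [abs_of_nonneg (mul_nonneg (S.weight s).2.le (norm_nonneg _))] at h
  refine h.trans (le_of_eq (by ring))

/-- The image of a pure tensor `a ⊗ b`. -/
noncomputable def pureTensor (S T : NormedSet.{u}) (a : (S.free k H).carrier)
    (b : (T.free k H).carrier) : ((S.tensor T).free k H).carrier :=
  (S.lift (fun s => (S.basisMul T s).1 b) ⟨‖(1 : H)‖ * ‖b‖, fun s => S.norm_basisMul_le T s b⟩).1 a

theorem norm_pureTensor_le (S T : NormedSet.{u}) (a : (S.free k H).carrier)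
    (b : (T.free k H).carrier) : ‖S.pureTensor T a b‖ ≤ ‖(1 : H)‖ * ‖b‖ * ‖a‖ := by
  have h := (S.summable_smul_and_bound ((S.tensor T).free k H)
    (fun s => (S.basisMul T s).1 b) (C := ‖(1 : H)‖ * ‖b‖) (fun s => S.norm_basisMul_le T s b) a).2
  rw [abs_of_nonneg (mul_nonneg (norm_nonneg _) (norm_nonneg _))] at h
  exact h

/-- The completed tensor product of two bounded maps between free modules. -/
noncomputable def tensorHom {S T S' T' : NormedSet.{u}}
    (f : BoundedHom (S.free k H) (T.free k H)) (g : BoundedHom (S'.free k H) (T'.free k H)) :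
    BoundedHom ((S.tensor S').free k H) ((T.tensor T').free k H) :=
  (S.tensor S').lift (fun p => T.pureTensor T' (f.1 (S.basis p.1)) (g.1 (S'.basis p.2))) (by
    obtain ⟨C, hC⟩ := f.2
    obtain ⟨D, hD⟩ := g.2
    refine ⟨‖(1 : H)‖ * (|D| * ‖(1 : H)‖) * (|C| * ‖(1 : H)‖), fun p => ?_⟩
    refine (T.norm_pureTensor_le T' _ _).trans ?_
    have hf : ‖f.1 (S.basis p.1)‖ ≤ |C| * ((S.weight p.1).1 * ‖(1 : H)‖) :=
      ((hC _).trans (mul_le_mul_of_nonneg_right (le_abs_self C) (norm_nonneg _))).trans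
        (le_of_eq (by rw [norm_basis]))
    have hg : ‖g.1 (S'.basis p.2)‖ ≤ |D| * ((S'.weight p.2).1 * ‖(1 : H)‖) :=
      ((hD _).trans (mul_le_mul_of_nonneg_right (le_abs_self D) (norm_nonneg _))).trans
        (le_of_eq (by rw [norm_basis]))
    have hw := (S.weight p.1).2.le
    have hw' := (S'.weight p.2).2.le
    calc _ ≤ ‖(1 : H)‖ * (|D| * ((S'.weight p.2).1 * ‖(1 : H)‖)) *
          (|C| * ((S.weight p.1).1 * ‖(1 : H)‖)) := by gcongr
      _ = _ := by
        change _ = _ * ((S.weight p.1).1 * (S'.weight p.2).1)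
        ring)

theorem push_basis {S T : NormedSet.{u}} (φ : S.carrier → T.carrier)
    (hφ : ∀ s, (T.weight (φ s)).1 ≤ (S.weight s).1) (s : S.carrier) :
    (push k H φ hφ).1 (S.basis s) = T.basis (φ s) :=
  S.lift_basis _ _ s

theorem pureTensor_basis (S T : NormedSet.{u}) (s : S.carrier) (t : T.carrier) :
    S.pureTensor (k := k) (H := H) T (S.basis s) (T.basis t) = (S.tensor T).basis (s, t) :=
  (S.lift_basis _ _ s).trans (T.lift_basis _ _ t)

theorem tensorHom_basis {S T S' T' : NormedSet.{u}}
    (f : BoundedHom (S.free k H) (T.free k H)) (g : BoundedHom (S'.free k H) (T'.free k H))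
    (p : S.carrier × S'.carrier) : (tensorHom f g).1 ((S.tensor S').basis p) =
      T.pureTensor T' (f.1 (S.basis p.1)) (g.1 (S'.basis p.2)) :=
  (S.tensor S').lift_basis _ _ p

end NormedSet

/-- Additive `H`-linear presheaves on the free Banach modules. Every (ind-)Banach module `M` gives one,
whose points on `S` are the maps from the free module on `S` to `M`, that is the bounded families
indexed by `S`. As the free modules are compact projective generators, the left heart of the
quasi-abelian category `Ind(Ban_H)` consists of such presheaves (see `HeartModule.InLeftHeart`), with
kernels, cokernels and images computed pointwise. -/
structure HeartModule (k : BanachKind) (H : Type u) [NormedCommRing H] [BanachBase k H] where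
  pts : NormedSet.{u} → Type u
  [group : ∀ S, AddCommGroup (pts S)]
  [module : ∀ S, Module H (pts S)]
  map : ∀ {S T : NormedSet.{u}}, BoundedHom (S.free k H) (T.free k H) →ₗ[H] pts T →ₗ[H] pts S
  map_id : ∀ (S : NormedSet.{u}) (x : pts S), map (BoundedHom.id (S.free k H)) x = x
  map_comp : ∀ {S T U : NormedSet.{u}} (f : BoundedHom (S.free k H) (T.free k H))
    (g : BoundedHom (T.free k H) (U.free k H)) (x : pts U),
    map (BoundedHom.comp g f) x = map f (map g x)

attribute [instance] HeartModule.group HeartModule.module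

namespace HeartModule

variable {k : BanachKind} {H : Type u} [NormedCommRing H] [BanachBase k H]

@[ext]
structure Hom (M N : HeartModule k H) where
  app : ∀ S, M.pts S →ₗ[H] N.pts S
  naturality : ∀ {S T : NormedSet.{u}} (f : BoundedHom (S.free k H) (T.free k H)) (x : M.pts T),
    app S (M.map f x) = N.map f (app T x)

def Hom.comp {M N P : HeartModule k H} (g : Hom N P) (f : Hom M N) : Hom M P where
  app S := g.app S ∘ₗ f.app S
  naturality u x := by simp [f.naturality, g.naturality]

/-- Subobjects. -/
@[ext]
structure Sub (M : HeartModule k H) where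
  carrier : ∀ S, Submodule H (M.pts S)
  map_mem : ∀ {S T : NormedSet.{u}} (f : BoundedHom (S.free k H) (T.free k H)) {x : M.pts T},
    x ∈ carrier T → M.map f x ∈ carrier S

instance (M : HeartModule k H) : PartialOrder (Sub M) :=
  PartialOrder.lift Sub.carrier fun _ _ h => Sub.ext h

/-- The subobject is generated by a small family of points, so that it is an object of the left
heart. (There is a proper class of normed sets.) -/
def Sub.IsSmall {M : HeartModule k H} (N : Sub M) : Prop :=
  ∃ (ι : Type u) (S : ι → NormedSet.{u}) (x : ∀ i, M.pts (S i)),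
    (∀ i, x i ∈ N.carrier (S i)) ∧ ∀ N' : Sub M, (∀ i, x i ∈ N'.carrier (S i)) → N ≤ N'

/-- The kernel. -/
def Hom.ker {M N : HeartModule k H} (f : Hom M N) : Sub M where
  carrier S := LinearMap.ker (f.app S)
  map_mem u x hx := by
    rw [LinearMap.mem_ker] at hx ⊢
    rw [f.naturality, hx, map_zero]

end HeartModule

/-- The choice between `Ind(Ban_H)` and `Ind^m(Ban_H)` (monomorphic transition maps). -/
inductive IndKind
  | ind
  | indMono

/-- `M` is the presheaf of the ind-Banach module given by the small filtered diagram `V`, with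
monomorphic transition maps in the case of `Ind^m`: as the free modules are Banach, maps from
them to the formal filtered colimit of `V` are the filtered colimit of the maps to the `V j`. -/
structure IndBanachPresentation (κ : IndKind) {k : BanachKind} {H : Type u} [NormedCommRing H]
    [BanachBase k H] (M : HeartModule k H) where
  J : Type u
  [category : SmallCategory J]
  [filtered : IsFiltered J]
  V : J ⥤ BanachModule k H
  mono : κ = .indMono → ∀ {i j : J} (e : i ⟶ j), Function.Injective (V.map e : BoundedHom _ _).1
  ι : ∀ (j : J) (S : NormedSet.{u}), BoundedHom (S.free k H) (V.obj j) →ₗ[H] M.pts S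
  ι_naturality : ∀ (j : J) {S T : NormedSet.{u}} (f : BoundedHom (S.free k H) (T.free k H))
    (v : BoundedHom (T.free k H) (V.obj j)), ι j S (BoundedHom.comp v f) = M.map f (ι j T v)
  ι_map : ∀ {i j : J} (e : i ⟶ j) (S : NormedSet.{u}) (v : BoundedHom (S.free k H) (V.obj i)),
    ι j S (BoundedHom.comp (V.map e) v) = ι i S v
  exists_rep : ∀ (S : NormedSet.{u}) (x : M.pts S), ∃ (j : J) (v : _), ι j S v = x
  eventually_zero : ∀ (i : J) (S : NormedSet.{u}) (v : BoundedHom (S.free k H) (V.obj i)),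
    ι i S v = 0 → ∃ (j : J) (e : i ⟶ j), BoundedHom.comp (V.map e) v = 0

/-- Objects of `Ind(Ban_H)`, respectively `Ind^m(Ban_H)`. -/
def HeartModule.IsIndBanach (κ : IndKind) {k : BanachKind} {H : Type u} [NormedCommRing H]
    [BanachBase k H] (M : HeartModule k H) : Prop :=
  Nonempty (IndBanachPresentation κ M)

/-- Objects of the left heart: quotients of an ind-Banach module by a subobject in the left heart.
They include the ind-Banach modules themselves, as well as all homotopy objects of simplicial
ind-Banach modules and the quotients of these. -/
def HeartModule.InLeftHeart (κ : IndKind) {k : BanachKind} {H : Type u} [NormedCommRing H]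
    [BanachBase k H] (M : HeartModule k H) : Prop :=
  ∃ (N : HeartModule k H) (π : HeartModule.Hom N M), N.IsIndBanach κ ∧
    (∀ S, Function.Surjective (π.app S)) ∧ π.ker.IsSmall

/-- Commutative algebra objects: the multiplication is given on generalized points, `mul x y` being the
composite of `x ⊗ y` with the multiplication. For ind-Banach modules these are the commutative
algebras in `Ind(Ban_H)` for the completed tensor product. -/
structure HeartRing (k : BanachKind) (H : Type u) [NormedCommRing H] [BanachBase k H] extends
    HeartModule k H where
  one : pts NormedSet.point
  mul : ∀ {S T : NormedSet.{u}}, pts S →ₗ[H] pts T →ₗ[H] pts (S.tensor T)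
  mul_natural : ∀ {S T S' T' : NormedSet.{u}} (f : BoundedHom (S.free k H) (T.free k H))
    (g : BoundedHom (S'.free k H) (T'.free k H)) (x : pts T) (y : pts T'),
    mul (map f x) (map g y) = map (NormedSet.tensorHom f g) (mul x y)
  mul_assoc : ∀ {S T U : NormedSet.{u}} (x : pts S) (y : pts T) (z : pts U),
    mul (mul x y) z = map (NormedSet.push k H (S := (S.tensor T).tensor U)
      (T := S.tensor (T.tensor U)) (fun p => (p.1.1, (p.1.2, p.2)))
      fun _ => (_root_.mul_assoc _ _ _).ge) (mul x (mul y z))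
  mul_comm : ∀ {S T : NormedSet.{u}} (x : pts S) (y : pts T),
    mul y x = map (NormedSet.push k H (S := T.tensor S) (T := S.tensor T) Prod.swap
      fun _ => (_root_.mul_comm _ _).le) (mul x y)
  one_mul : ∀ {S : NormedSet.{u}} (x : pts S),
    mul one x = map (NormedSet.push k H (S := NormedSet.point.tensor S) (T := S) Prod.snd
      fun _ => (_root_.one_mul _).ge) x

namespace HeartRing

variable {k : BanachKind} {H : Type u} [NormedCommRing H] [BanachBase k H]

@[ext]
structure Hom (A B : HeartRing k H) extends HeartModule.Hom A.toHeartModule B.toHeartModule where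
  map_one : app _ A.one = B.one
  map_mul : ∀ {S T : NormedSet.{u}} (x : A.pts S) (y : A.pts T),
    app _ (A.mul x y) = B.mul (app S x) (app T y)

instance : Category (HeartRing k H) where
  Hom := Hom
  id A := ⟨⟨fun _ => LinearMap.id, fun _ _ => rfl⟩, rfl, fun _ _ => rfl⟩
  comp f g := ⟨g.toHom.comp f.toHom,
    by simp [HeartModule.Hom.comp, f.map_one, g.map_one],
    fun x y => by simp [HeartModule.Hom.comp, f.map_mul, g.map_mul]⟩

/-- Ideals. -/
@[ext]
structure IdealObj (A : HeartRing k H) extends HeartModule.Sub A.toHeartModule where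
  mul_mem : ∀ {S T : NormedSet.{u}} (a : A.pts S) {x : A.pts T}, x ∈ carrier T →
    A.mul a x ∈ carrier (S.tensor T)

namespace IdealObj

variable {A : HeartRing k H}

instance : PartialOrder (IdealObj A) :=
  PartialOrder.lift IdealObj.toSub fun _ _ h => IdealObj.ext (congrArg HeartModule.Sub.carrier h)

instance : OrderBot (IdealObj A) where
  bot :=
    { carrier := fun _ => ⊥
      map_mem := fun f x hx => by
        rw [Submodule.mem_bot] at hx ⊢
        rw [hx, map_zero]
      mul_mem := fun a x hx => by
        rw [Submodule.mem_bot] at hx ⊢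
        rw [hx, map_zero] }
  bot_le I := fun _ => bot_le

theorem mul_mem_right (I : IdealObj A) {S T : NormedSet.{u}} {x : A.pts S} (hx : x ∈ I.carrier S)
    (a : A.pts T) : A.mul x a ∈ I.carrier (S.tensor T) := by
  rw [A.mul_comm]
  exact I.map_mem _ (I.mul_mem a hx)

/-- The products of `n + 1` factors from `I`; they generate the ideal `I ^ (n + 1)`. -/
inductive IsPowerProduct (I : IdealObj A) : ℕ → ∀ S : NormedSet.{u}, A.pts S → Prop
  | base {S : NormedSet.{u}} {x : A.pts S} : x ∈ I.carrier S → IsPowerProduct I 0 S x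
  | step {n : ℕ} {S T : NormedSet.{u}} {x : A.pts S} {y : A.pts T} : IsPowerProduct I n S x →
      y ∈ I.carrier T → IsPowerProduct I (n + 1) (S.tensor T) (A.mul x y)

/-- Some power of the ideal is zero. -/
def IsNilpotent (I : IdealObj A) : Prop :=
  ∃ n : ℕ, ∀ (S : NormedSet.{u}) (x : A.pts S), IsPowerProduct I n S x → x = 0

end IdealObj

variable (A : HeartRing k H)

noncomputable def quotMap (I : IdealObj A) {S T : NormedSet.{u}} :
    BoundedHom (S.free k H) (T.free k H) →ₗ[H]
      (A.pts T ⧸ I.carrier T) →ₗ[H] (A.pts S ⧸ I.carrier S) where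
  toFun f := Submodule.mapQ (I.carrier T) (I.carrier S) (A.map f) fun _ hx => I.map_mem f hx
  map_add' f g := by
    refine LinearMap.ext fun x => ?_
    obtain ⟨x, rfl⟩ := Submodule.mkQ_surjective _ x
    exact congrArg (I.carrier S).mkQ (DFunLike.congr_fun (A.map.map_add f g) x)
  map_smul' c f := by
    refine LinearMap.ext fun x => ?_
    obtain ⟨x, rfl⟩ := Submodule.mkQ_surjective _ x
    exact congrArg (I.carrier S).mkQ (DFunLike.congr_fun (A.map.map_smul c f) x)

noncomputable def quotMul (I : IdealObj A) {S T : NormedSet.{u}} :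
    (A.pts S ⧸ I.carrier S) →ₗ[H] (A.pts T ⧸ I.carrier T) →ₗ[H]
      (A.pts (S.tensor T) ⧸ I.carrier (S.tensor T)) :=
  Submodule.liftQ (I.carrier S)
    (LinearMap.flip (Submodule.liftQ (I.carrier T)
      (LinearMap.flip (A.mul.compr₂ (I.carrier (S.tensor T)).mkQ)) fun y hy =>
        LinearMap.ext fun x =>
          (Submodule.Quotient.mk_eq_zero _).2 (I.mul_mem x hy))) fun x hx =>
      LinearMap.ext fun y => by
        obtain ⟨y, rfl⟩ := Submodule.mkQ_surjective _ y
        exact (Submodule.Quotient.mk_eq_zero _).2 (I.mul_mem_right hx y)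

/-- The quotient algebra. -/
noncomputable def quot (I : IdealObj A) : HeartRing k H where
  pts S := A.pts S ⧸ I.carrier S
  map := A.quotMap I
  map_id S x := by
    obtain ⟨x, rfl⟩ := Submodule.mkQ_surjective _ x
    exact congrArg (I.carrier S).mkQ (A.map_id S x)
  map_comp {S T U} f g x := by
    obtain ⟨x, rfl⟩ := Submodule.mkQ_surjective _ x
    exact congrArg (I.carrier S).mkQ (A.map_comp f g x)
  one := (I.carrier _).mkQ A.one
  mul := A.quotMul I
  mul_natural f g x y := by
    obtain ⟨x, rfl⟩ := Submodule.mkQ_surjective _ x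
    obtain ⟨y, rfl⟩ := Submodule.mkQ_surjective _ y
    exact congrArg (I.carrier _).mkQ (A.mul_natural f g x y)
  mul_assoc x y z := by
    obtain ⟨x, rfl⟩ := Submodule.mkQ_surjective _ x
    obtain ⟨y, rfl⟩ := Submodule.mkQ_surjective _ y
    obtain ⟨z, rfl⟩ := Submodule.mkQ_surjective _ z
    exact congrArg (I.carrier _).mkQ (A.mul_assoc x y z)
  mul_comm x y := by
    obtain ⟨x, rfl⟩ := Submodule.mkQ_surjective _ x
    obtain ⟨y, rfl⟩ := Submodule.mkQ_surjective _ y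
    exact congrArg (I.carrier _).mkQ (A.mul_comm x y)
  one_mul x := by
    obtain ⟨x, rfl⟩ := Submodule.mkQ_surjective _ x
    exact congrArg (I.carrier _).mkQ (A.one_mul x)

noncomputable def mkQuot (I : IdealObj A) : A ⟶ A.quot I :=
  ⟨⟨fun S => (I.carrier S).mkQ, fun _ _ => rfl⟩, rfl, fun _ _ => rfl⟩

/-- The projection from `A/I` to `A/J` for `I ≤ J`. -/
noncomputable def quotFactor {I J : IdealObj A} (h : I ≤ J) : A.quot I ⟶ A.quot J where
  app S := Submodule.mapQ _ _ LinearMap.id (h S)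
  naturality f x := by
    obtain ⟨x, rfl⟩ := Submodule.mkQ_surjective _ x
    rfl
  map_one := rfl
  map_mul x y := by
    obtain ⟨x, rfl⟩ := Submodule.mkQ_surjective _ x
    obtain ⟨y, rfl⟩ := Submodule.mkQ_surjective _ y
    rfl

/-- The underlying commutative ring of an algebra: its `H`-valued points, the maps from `H` to it as a
module. For a Banach algebra this is the algebra itself. -/
def Sections : Type u := A.pts NormedSet.point

instance : AddCommGroup A.Sections := inferInstanceAs (AddCommGroup (A.pts NormedSet.point))

noncomputable def diag (k : BanachKind) (H : Type u) [NormedCommRing H] [BanachBase k H] :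
    BoundedHom (NormedSet.point.{u}.free k H)
      ((NormedSet.point.tensor NormedSet.point).free k H) :=
  NormedSet.push k H (fun s => (s, s)) fun _ => (_root_.mul_one (1 : ℝ)).le

theorem diag_basis (s : NormedSet.point.{u}.carrier) : (diag k H).1 (NormedSet.point.{u}.basis s) =
    (NormedSet.point.tensor NormedSet.point).basis (s, s) :=
  NormedSet.push_basis (S := NormedSet.point.{u}) _ _ s

noncomputable def sectionMul (x y : A.pts NormedSet.point) : A.pts NormedSet.point :=
  A.map (diag k H) (A.mul x y)

theorem sectionMul_comm (x y : A.pts NormedSet.point) :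
    A.sectionMul x y = A.sectionMul y x := by
  rw [sectionMul, sectionMul, A.mul_comm x y, ← A.map_comp]
  congr 2
  refine NormedSet.hom_ext fun s => ?_
  rw [BoundedHom.comp_apply, diag_basis, NormedSet.push_basis]

theorem one_sectionMul (x : A.pts NormedSet.point) : A.sectionMul A.one x = x := by
  rw [sectionMul, A.one_mul, ← A.map_comp]
  conv_rhs => rw [← A.map_id _ x]
  congr 2
  refine NormedSet.hom_ext fun s => ?_
  rw [BoundedHom.comp_apply, diag_basis, NormedSet.push_basis]
  rfl

theorem sectionMul_assoc (x y z : A.pts NormedSet.point) :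
    A.sectionMul (A.sectionMul x y) z = A.sectionMul x (A.sectionMul y z) := by
  have h1 := A.mul_natural (diag k H) (BoundedHom.id (NormedSet.point.free k H)) (A.mul x y) z
  have h2 := A.mul_natural (BoundedHom.id (NormedSet.point.free k H)) (diag k H) x (A.mul y z)
  rw [A.map_id] at h1 h2
  rw [sectionMul, sectionMul, sectionMul, sectionMul, h1, h2, A.mul_assoc, ← A.map_comp,
    ← A.map_comp, ← A.map_comp]
  congr 2
  refine NormedSet.hom_ext fun s => ?_
  rw [BoundedHom.comp_apply, BoundedHom.comp_apply, BoundedHom.comp_apply, diag_basis,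
    NormedSet.tensorHom_basis, NormedSet.tensorHom_basis, diag_basis, BoundedHom.id_apply,
    NormedSet.pureTensor_basis, NormedSet.pureTensor_basis,
    NormedSet.push_basis]

theorem sectionMul_add (x y z : A.pts NormedSet.point) :
    A.sectionMul x (y + z) = A.sectionMul x y + A.sectionMul x z := by
  simp only [sectionMul, map_add]

theorem sectionMul_zero (x : A.pts NormedSet.point) : A.sectionMul x 0 = 0 := by
  simp only [sectionMul, map_zero]

noncomputable instance : CommRing A.Sections :=
  { (inferInstance : AddCommGroup A.Sections) with
    mul := A.sectionMul
    one := A.one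
    left_distrib := A.sectionMul_add
    right_distrib := fun x y z => (A.sectionMul_comm _ z).trans
      ((A.sectionMul_add z x y).trans (congrArg₂ (fun a b => a + b)
        (A.sectionMul_comm z x) (A.sectionMul_comm z y)))
    zero_mul := fun x => (A.sectionMul_comm 0 x).trans (A.sectionMul_zero x)
    mul_zero := A.sectionMul_zero
    mul_assoc := A.sectionMul_assoc
    mul_comm := A.sectionMul_comm
    one_mul := A.one_sectionMul
    mul_one := fun x => (A.sectionMul_comm x A.one).trans (A.one_sectionMul x) }

/-- The ideal of the underlying ring given by an ideal. -/
def IdealObj.sections {A : HeartRing k H} (I : IdealObj A) : Ideal A.Sections where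
  carrier := {x | x ∈ I.carrier NormedSet.point}
  zero_mem' := (I.carrier _).zero_mem
  add_mem' := fun hx hy => (I.carrier _).add_mem hx hy
  smul_mem' := fun a _ hx => I.map_mem (diag k H) (I.mul_mem a hx)

theorem IdealObj.sections_bot : (⊥ : IdealObj A).sections = ⊥ := rfl

end HeartRing

namespace HeartRing

variable {k : BanachKind} {H : Type u} [NormedCommRing H] [BanachBase k H]

def app {A B : HeartRing k H} (f : A ⟶ B) (S : NormedSet.{u}) : A.pts S →ₗ[H] B.pts S :=
  HeartModule.Hom.app (Hom.toHom f) S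

theorem app_map {A B : HeartRing k H} (f : A ⟶ B) {S T : NormedSet.{u}}
    (u : BoundedHom (S.free k H) (T.free k H)) (x : A.pts T) :
    app f S (A.map u x) = B.map u (app f T x) :=
  (Hom.toHom f).naturality u x

theorem app_mul {A B : HeartRing k H} (f : A ⟶ B) {S T : NormedSet.{u}} (x : A.pts S)
    (y : A.pts T) : app f _ (A.mul x y) = B.mul (app f S x) (app f T y) :=
  Hom.map_mul f x y

theorem app_comp {A B C : HeartRing k H} (f : A ⟶ B) (g : B ⟶ C) (S : NormedSet.{u})
    (x : A.pts S) : app (f ≫ g) S x = app g S (app f S x) := rfl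

theorem app_id (A : HeartRing k H) (S : NormedSet.{u}) (x : A.pts S) : app (𝟙 A) S x = x := rfl

def ptsFunctor (k : BanachKind) (H : Type u) [NormedCommRing H] [BanachBase k H]
    (S : NormedSet.{u}) : HeartRing k H ⥤ Type u where
  obj A := A.pts S
  map f := ↾(app f S)

end HeartRing

/-- Simplicial commutative algebras. Simplicial objects of the left heart present the same
`∞`-category as simplicial objects of `Ind(Ban_H)` (both are generated by the free modules under
sifted colimits), and they contain the discrete objects `π₀(R)/I` as constant objects. -/
abbrev SimplicialRing (k : BanachKind) (H : Type u) [NormedCommRing H] [BanachBase k H] :=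
  SimplicialObject (HeartRing k H)

namespace SimplicialRing

variable {k : BanachKind} {H : Type u} [NormedCommRing H] [BanachBase k H]

abbrev level (R : SimplicialRing k H) (n : ℕ) : HeartRing k H := R.obj (op (SimplexCategory.mk n))

theorem level_comp (R : SimplicialRing k H) {a b c : SimplexCategory} (f : a ⟶ b) (g : b ⟶ c)
    (S : NormedSet.{u}) (x : (R.obj (op c)).pts S) :
    HeartRing.app (R.map f.op) S (HeartRing.app (R.map g.op) S x) =
      HeartRing.app (R.map (f ≫ g).op) S x := by
  rw [op_comp, R.map_comp]
  rfl

theorem level_map_comm {R R' : SimplicialRing k H} (φ : R ⟶ R') {a b : SimplexCategory}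
    (f : a ⟶ b) (S : NormedSet.{u}) (x : (R.obj (op b)).pts S) :
    HeartRing.app (φ.app (op a)) S (HeartRing.app (R.map f.op) S x) =
      HeartRing.app (R'.map f.op) S (HeartRing.app (φ.app (op b)) S x) := by
  rw [← HeartRing.app_comp, φ.naturality, HeartRing.app_comp]

/-- The ideal of all `d₀ x - d₁ x`. -/
def boundaryIdeal (R : SimplicialRing k H) : HeartRing.IdealObj (R.level 0) where
  carrier S := LinearMap.range (HeartRing.app (R.δ (n := 0) 0) S - HeartRing.app (R.δ (n := 0) 1) S)
  map_mem := by
    rintro S T f _ ⟨x, rfl⟩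
    refine ⟨(R.level 1).map f x, ?_⟩
    rw [LinearMap.sub_apply, LinearMap.sub_apply, map_sub, HeartRing.app_map, HeartRing.app_map]
  mul_mem := by
    rintro S T a _ ⟨x, rfl⟩
    have h0 : HeartRing.app (R.δ (n := 0) 0) S (HeartRing.app (R.σ (n := 0) 0) S a) = a := by
      rw [← HeartRing.app_comp]
      exact congrArg (fun f => HeartRing.app f S a) (R.δ_comp_σ_self (i := (0 : Fin 1)))
    have h1 : HeartRing.app (R.δ (n := 0) 1) S (HeartRing.app (R.σ (n := 0) 0) S a) = a := by
      rw [← HeartRing.app_comp]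
      exact congrArg (fun f => HeartRing.app f S a) (R.δ_comp_σ_succ (i := (0 : Fin 1)))
    refine ⟨(R.level 1).mul (HeartRing.app (R.σ (n := 0) 0) S a) x, ?_⟩
    rw [LinearMap.sub_apply, LinearMap.sub_apply, map_sub, HeartRing.app_mul, HeartRing.app_mul,
      h0, h1]

/-- The algebra `π₀(R)`. -/
noncomputable def piZero (R : SimplicialRing k H) : HeartRing k H :=
  (R.level 0).quot R.boundaryIdeal

noncomputable def toPiZero (R : SimplicialRing k H) : R.level 0 ⟶ R.piZero :=
  (R.level 0).mkQuot R.boundaryIdeal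

theorem delta_comp_toPiZero (R : SimplicialRing k H) :
    R.δ (n := 0) 0 ≫ R.toPiZero = R.δ (n := 0) 1 ≫ R.toPiZero := by
  refine HeartRing.Hom.ext (funext fun S => LinearMap.ext fun x => ?_)
  exact (Submodule.Quotient.eq _).2 ⟨x, rfl⟩

theorem vertex_comp_toPiZero (R : SimplicialRing k H) (n : SimplexCategory)
    (v : SimplexCategory.mk 0 ⟶ n) :
    R.map v.op ≫ R.toPiZero = R.map (SimplexCategory.const _ n 0).op ≫ R.toPiZero := by
  let e : SimplexCategory.mk 1 ⟶ n :=
    SimplexCategory.mkOfLe (n := n.len) 0 (v.toOrderHom 0) (Fin.zero_le _)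
  have h0 : SimplexCategory.δ 0 ≫ e = v := by
    ext i
    fin_cases i
    rfl
  have h1 : SimplexCategory.δ 1 ≫ e = SimplexCategory.const _ n 0 := by
    ext i
    fin_cases i
    rfl
  rw [← h0, ← h1, op_comp, op_comp, R.map_comp, R.map_comp, Category.assoc, Category.assoc]
  exact congrArg (fun f => R.map e.op ≫ f) R.delta_comp_toPiZero

/-- The augmentation from `R` to the discrete object `π₀(R)`. -/
noncomputable def toConst (R : SimplicialRing k H) :
    R ⟶ (SimplicialObject.const (HeartRing k H)).obj R.piZero where
  app n := R.map (SimplexCategory.const _ n.unop 0).op ≫ R.toPiZero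
  naturality m n θ := by
    rw [← Category.assoc, ← R.map_comp]
    exact (R.vertex_comp_toPiZero _ _).trans (Category.comp_id _).symm

end SimplicialRing

namespace HeartModule

variable {k : BanachKind} {H : Type u} [NormedCommRing H] [BanachBase k H]

noncomputable def subquotMap (M : HeartModule k H) (Z B : Sub M) {S T : NormedSet.{u}} :
    BoundedHom (S.free k H) (T.free k H) →ₗ[H]
      (Z.carrier T ⧸ (B.carrier T).submoduleOf (Z.carrier T)) →ₗ[H]
      (Z.carrier S ⧸ (B.carrier S).submoduleOf (Z.carrier S)) where
  toFun f := Submodule.mapQ _ _ ((M.map f).restrict fun _ hx => Z.map_mem f hx)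
    fun x hx => B.map_mem f (x := x.1) hx
  map_add' f g := by
    refine LinearMap.ext fun x => ?_
    obtain ⟨x, rfl⟩ := Submodule.mkQ_surjective _ x
    exact congrArg (Submodule.mkQ _) (Subtype.ext (DFunLike.congr_fun (M.map.map_add f g) x.1))
  map_smul' c f := by
    refine LinearMap.ext fun x => ?_
    obtain ⟨x, rfl⟩ := Submodule.mkQ_surjective _ x
    exact congrArg (Submodule.mkQ _) (Subtype.ext (DFunLike.congr_fun (M.map.map_smul c f) x.1))

/-- The quotient of `Z` by `Z ∩ B`. -/
noncomputable def subquot (M : HeartModule k H) (Z B : Sub M) : HeartModule k H where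
  pts S := Z.carrier S ⧸ (B.carrier S).submoduleOf (Z.carrier S)
  map := M.subquotMap Z B
  map_id S x := by
    obtain ⟨x, rfl⟩ := Submodule.mkQ_surjective _ x
    exact congrArg (Submodule.mkQ _) (Subtype.ext (M.map_id S x.1))
  map_comp f g x := by
    obtain ⟨x, rfl⟩ := Submodule.mkQ_surjective _ x
    exact congrArg (Submodule.mkQ _) (Subtype.ext (M.map_comp f g x.1))

end HeartModule

/-- Module objects over an algebra `P`. -/
structure HeartRing.ModuleObj {k : BanachKind} {H : Type u} [NormedCommRing H] [BanachBase k H]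
    (P : HeartRing k H) extends HeartModule k H where
  act : ∀ {S T : NormedSet.{u}}, P.pts S →ₗ[H] pts T →ₗ[H] pts (S.tensor T)
  act_natural : ∀ {S T S' T' : NormedSet.{u}} (f : BoundedHom (S.free k H) (T.free k H))
    (g : BoundedHom (S'.free k H) (T'.free k H)) (a : P.pts T) (m : pts T'),
    act (P.map f a) (map g m) = map (NormedSet.tensorHom f g) (act a m)
  mul_act : ∀ {S T U : NormedSet.{u}} (a : P.pts S) (b : P.pts T) (m : pts U),
    act (P.mul a b) m = map (NormedSet.push k H (S := (S.tensor T).tensor U)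
      (T := S.tensor (T.tensor U)) (fun p => (p.1.1, (p.1.2, p.2)))
      fun _ => (_root_.mul_assoc _ _ _).ge) (act a (act b m))
  one_act : ∀ {S : NormedSet.{u}} (m : pts S),
    act P.one m = map (NormedSet.push k H (S := NormedSet.point.tensor S) (T := S) Prod.snd
      fun _ => (_root_.one_mul _).ge) m

namespace SimplicialRing

variable {k : BanachKind} {H : Type u} [NormedCommRing H] [BanachBase k H]

noncomputable def piZeroMap {A B : SimplicialRing k H} (φ : A ⟶ B) : A.piZero ⟶ B.piZero where
  app S := Submodule.mapQ (A.boundaryIdeal.carrier S) (B.boundaryIdeal.carrier S)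
    (HeartRing.app (φ.app (op (SimplexCategory.mk 0))) S) (by
      rintro _ ⟨x, rfl⟩
      refine ⟨HeartRing.app (φ.app (op (SimplexCategory.mk 1))) S x, ?_⟩
      rw [LinearMap.sub_apply, LinearMap.sub_apply, map_sub]
      exact congrArg₂ (fun a b => a - b) (level_map_comm φ _ S x).symm
        (level_map_comm φ _ S x).symm)
  naturality f x := by
    obtain ⟨x, rfl⟩ := Submodule.mkQ_surjective _ x
    exact congrArg (Submodule.mkQ _) (HeartRing.app_map _ f x)
  map_one := congrArg (Submodule.mkQ _) (HeartRing.Hom.map_one _)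
  map_mul x y := by
    obtain ⟨x, rfl⟩ := Submodule.mkQ_surjective _ x
    obtain ⟨y, rfl⟩ := Submodule.mkQ_surjective _ y
    exact congrArg (Submodule.mkQ _) (HeartRing.app_mul _ x y)

/-- Intersection of the kernels of the faces `d_i` with `P i`. -/
def faceKer (A : SimplicialRing k H) (n : ℕ) (P : Fin (n + 2) → Prop) :
    HeartModule.Sub (A.level (n + 1)).toHeartModule where
  carrier S := ⨅ (i : Fin (n + 2)) (_ : P i), LinearMap.ker (HeartRing.app (A.δ i) S)
  map_mem f x hx := by
    simp only [Submodule.mem_iInf, LinearMap.mem_ker] at hx ⊢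
    intro i hi
    rw [HeartRing.app_map, hx i hi, map_zero]

/-- Moore cycles: all faces vanish. -/
def cycles (A : SimplicialRing k H) : ∀ n : ℕ, HeartModule.Sub (A.level n).toHeartModule
  | 0 => { carrier := fun _ => ⊤, map_mem := fun _ _ _ => trivial }
  | n + 1 => A.faceKer n fun _ => True

/-- Images under `d₀` of the elements whose other faces vanish. -/
def boundaries (A : SimplicialRing k H) (n : ℕ) : HeartModule.Sub (A.level n).toHeartModule where
  carrier S := Submodule.map (HeartRing.app (A.δ (n := n) 0) S)
    ((A.faceKer n fun i => i ≠ 0).carrier S)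
  map_mem := by
    rintro S T f _ ⟨x, hx, rfl⟩
    exact ⟨(A.level (n + 1)).map f x, (A.faceKer n fun i => i ≠ 0).map_mem f hx,
      HeartRing.app_map _ f x⟩

/-- The module `π_n(A)` over `π₀(A)`. -/
noncomputable def homotopy (A : SimplicialRing k H) (n : ℕ) : HeartModule k H :=
  (A.level n).toHeartModule.subquot (A.cycles n) (A.boundaries n)

noncomputable def cycleClass (A : SimplicialRing k H) {n : ℕ} {S : NormedSet.{u}}
    (z : (A.cycles n).carrier S) : (A.homotopy n).pts S :=
  Submodule.mkQ _ z

def cyclesMap {A B : SimplicialRing k H} (φ : A ⟶ B) {n : ℕ} {S : NormedSet.{u}}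
    (z : (A.cycles n).carrier S) : (B.cycles n).carrier S :=
  ⟨HeartRing.app (φ.app (op (SimplexCategory.mk n))) S z.1, by
    cases n with
    | zero => trivial
    | succ n =>
      have hz : z.1 ∈ (A.faceKer n fun _ => True).carrier S := z.2
      change _ ∈ (B.faceKer n fun _ => True).carrier S
      simp only [faceKer, Submodule.mem_iInf, LinearMap.mem_ker] at hz ⊢
      intro i hi
      refine (level_map_comm φ (SimplexCategory.δ i) S z.1).symm.trans ?_
      exact (congrArg _ (hz i hi)).trans (map_zero _)⟩

/-- The action of `A_0` (through degeneracies) on cycles, which induces that of `π₀(A)` on `π_n(A)`. -/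
def cyclesSmul (A : SimplicialRing k H) {n : ℕ} {S T : NormedSet.{u}} (a : (A.level 0).pts S)
    (z : (A.cycles n).carrier T) : (A.cycles n).carrier (S.tensor T) :=
  ⟨(A.level n).mul (HeartRing.app
      (A.map (SimplexCategory.const (SimplexCategory.mk n) (SimplexCategory.mk 0) 0).op) S a) z.1, by
    cases n with
    | zero => trivial
    | succ n =>
      have hz : z.1 ∈ (A.faceKer n fun _ => True).carrier T := z.2
      change _ ∈ (A.faceKer n fun _ => True).carrier _
      simp only [faceKer, Submodule.mem_iInf, LinearMap.mem_ker] at hz ⊢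
      intro i hi
      rw [HeartRing.app_mul, hz i hi, map_zero]⟩

/-- `h` is linear over `ρ : π₀(A) ⟶ P`. -/
def IsPiZeroLinear (A : SimplicialRing k H) {n : ℕ} {P : HeartRing k H} (ρ : A.piZero ⟶ P)
    (N : P.ModuleObj) (h : HeartModule.Hom (A.homotopy n) N.toHeartModule) : Prop :=
  ∀ {S T : NormedSet.{u}} (a : (A.level 0).pts S) (z : (A.cycles n).carrier T),
    h.app _ (A.cycleClass (A.cyclesSmul a z)) =
      N.act (HeartRing.app ρ S (HeartRing.app A.toPiZero S a)) (h.app T (A.cycleClass z))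

/-- `π₀(B) ⊗_{π₀(A)} π_n(A) ⟶ π_n(B)` is an isomorphism for all `n`, that is `π_n(A) ⟶ π_n(B)` has the
universal property of the base change among all `π₀(B)`-modules. -/
def HomotopyBaseChange {A B : SimplicialRing k H} (φ : A ⟶ B) : Prop :=
  ∀ (n : ℕ) (N : B.piZero.ModuleObj) (h : HeartModule.Hom (A.homotopy n) N.toHeartModule),
    A.IsPiZeroLinear (piZeroMap φ) N h →
      ∃! h' : HeartModule.Hom (B.homotopy n) N.toHeartModule,
        B.IsPiZeroLinear (𝟙 B.piZero) N h' ∧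
          ∀ (S : NormedSet.{u}) (z : (A.cycles n).carrier S),
            h'.app S (B.cycleClass (cyclesMap φ z)) = h.app S (A.cycleClass z)

end SimplicialRing

namespace HeartRing

variable {k : BanachKind} {H : Type u} [NormedCommRing H] [BanachBase k H]

/-- `x` is an algebra homomorphism from `H⟨X_1, …, X_d⟩` to `B`: a map of the underlying free module that
respects unit and multiplication of monomials. -/
structure IsMonomialSystem (B : HeartRing k H) (d : ℕ) (x : B.pts (NormedSet.monomials d)) :
    Prop where
  one : B.map (NormedSet.push k H (S := NormedSet.point) (T := NormedSet.monomials d)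
    (fun _ => ⟨0⟩) fun _ => le_rfl) x = B.one
  mul : B.map (NormedSet.push k H
    (S := (NormedSet.monomials d).tensor (NormedSet.monomials d)) (T := NormedSet.monomials d)
    (fun p => ⟨p.1.down + p.2.down⟩) fun _ => (_root_.mul_one (1 : ℝ)).ge) x = B.mul x x

/-- There is a surjection `A⟨X_1, …, X_d⟩ ⟶ B` of `A`-algebras. As `A⟨X⟩ = A ⊗ H⟨X⟩`, such a map is an algebra
homomorphism `x` from `H⟨X⟩` to `B`, its image is generated by the products `φ(a) x`, and surjectivity
says that every subobject that contains these is all of `B`. -/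
def IsAffinoid {A B : HeartRing k H} (φ : A ⟶ B) : Prop :=
  ∃ (d : ℕ) (x : B.pts (NormedSet.monomials d)), B.IsMonomialSystem d x ∧
    ∀ N : HeartModule.Sub B.toHeartModule,
      (∀ (S : NormedSet.{u}) (a : A.pts S), B.mul (app φ S a) x ∈ N.carrier _) →
        ∀ (S : NormedSet.{u}) (b : B.pts S), b ∈ N.carrier S

end HeartRing

/-- Affinoid morphisms: `π₀(B)` is affinoid over `π₀(A)`, and `π_n(B)` is the base change of `π_n(A)`. -/
def SimplicialRing.IsAffinoid {k : BanachKind} {H : Type u} [NormedCommRing H] [BanachBase k H]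
    {A B : SimplicialRing k H} (φ : A ⟶ B) : Prop :=
  HeartRing.IsAffinoid (SimplicialRing.piZeroMap φ) ∧ SimplicialRing.HomotopyBaseChange φ

section HomotopyPullback

open CategoryTheory.Limits MonoidalCategory

/-- The path space `Y^{Δ[1]}`. -/
noncomputable abbrev pathFunctor : SSet.{u} ⥤ SSet.{u} :=
  ihom (SSet.stdSimplex.obj (SimplexCategory.mk 1))

noncomputable def vertexInclusion (i : Fin 2) (Y : SSet.{u}) :
    Y ⟶ SSet.stdSimplex.obj (SimplexCategory.mk 1) ⊗ Y :=
  CartesianMonoidalCategory.lift (SSet.const (SSet.stdSimplex.obj₀Equiv.symm i)) (𝟙 _)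

/-- Evaluation of paths at an endpoint. -/
noncomputable def endpoint (i : Fin 2) : pathFunctor.{u} ⟶ 𝟭 SSet.{u} where
  app Y := vertexInclusion i _ ≫ (ihom.ev (SSet.stdSimplex.obj (SimplexCategory.mk 1))).app Y
  naturality X Y f := by
    have h := (ihom.ev (SSet.stdSimplex.obj (SimplexCategory.mk 1))).naturality f
    simp only [Functor.id_map, Category.assoc] at h ⊢
    rw [← h, ← Category.assoc, ← Category.assoc]
    rfl

noncomputable def constantPath : 𝟭 SSet.{u} ⟶ pathFunctor.{u} where
  app Y := MonoidalClosed.curry (SemiCartesianMonoidalCategory.snd _ Y)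
  naturality X Y f := by
    change f ≫ MonoidalClosed.curry _ = MonoidalClosed.curry _ ≫ (ihom _).map f
    rw [← MonoidalClosed.curry_natural_left, ← MonoidalClosed.curry_natural_right]
    congr 1

theorem constantPath_endpoint (i : Fin 2) : constantPath.{u} ≫ endpoint i = 𝟙 _ := by
  ext Y : 2
  have h := MonoidalClosed.uncurry_curry (SemiCartesianMonoidalCategory.snd (SSet.stdSimplex.{u}.obj (SimplexCategory.mk 1)) Y)
  rw [MonoidalClosed.uncurry_eq] at h
  change MonoidalClosed.curry _ ≫ vertexInclusion i _ ≫ _ = 𝟙 Y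
  calc _ = vertexInclusion i Y ≫ (_ ◁ MonoidalClosed.curry (SemiCartesianMonoidalCategory.snd _ Y)) ≫ (ihom.ev (SSet.stdSimplex.obj (SimplexCategory.mk 1))).app Y := rfl
    _ = _ := by rw [h]; rfl

/-- The homotopy fibre product `X ×_Y Y^{Δ[1]} ×_Y Z` of diagrams of simplicial sets, for `Y` with values
in Kan complexes. -/
noncomputable def homotopyPullback {J : Type*} [Category* J] {X Y Z : J ⥤ SSet.{u}} (p : X ⟶ Y)
    (q : Z ⟶ Y) : J ⥤ SSet.{u} :=
  pullback (prod.map p q)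
    (prod.lift (Functor.whiskerLeft Y (endpoint 0)) (Functor.whiskerLeft Y (endpoint 1)) :
      Y ⋙ pathFunctor ⟶ Y ⨯ Y)

/-- The map to the homotopy fibre product given by a strictly commutative square. -/
noncomputable def homotopyPullbackLift {J : Type*} [Category* J] {W X Y Z : J ⥤ SSet.{u}}
    {p : X ⟶ Y} {q : Z ⟶ Y} (a : W ⟶ X) (b : W ⟶ Z) (h : a ≫ p = b ≫ q) :
    W ⟶ homotopyPullback p q :=
  pullback.lift (prod.lift a b) ((a ≫ p) ≫ Functor.whiskerLeft Y constantPath) (by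
    have e : ∀ i, Functor.whiskerLeft Y constantPath ≫ Functor.whiskerLeft Y (endpoint i) = 𝟙 Y :=
      fun i => (Functor.whiskerLeft_comp Y _ _).symm.trans (by rw [constantPath_endpoint]; rfl)
    rw [prod.lift_map, prod.comp_lift]
    refine congrArg₂ prod.lift ?_ ?_
    · rw [Category.assoc]
      exact ((congrArg (fun t => (a ≫ p) ≫ t) (e 0)).trans (Category.comp_id _)).symm
    · rw [Category.assoc]
      exact ((congrArg (fun t => (a ≫ p) ≫ t) (e 1)).trans ((Category.comp_id _).trans h)).symm)

end HomotopyPullback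

namespace HeartRing

variable {k : BanachKind} {H : Type u} [NormedCommRing H] [BanachBase k H]

/-- Nilpotent ideals in the left heart. No closedness is required. -/
structure NilpotentIdeal (P : HeartRing k H) where
  ideal : IdealObj P
  nilpotent : ideal.IsNilpotent
  small : ideal.toSub.IsSmall

instance (P : HeartRing k H) : PartialOrder P.NilpotentIdeal :=
  PartialOrder.lift NilpotentIdeal.ideal fun I J h => by
    cases I
    cases J
    cases h
    rfl

def NilpotentIdeal.zero (P : HeartRing k H) : P.NilpotentIdeal where
  ideal := ⊥
  nilpotent := ⟨0, fun _ _ h => by cases h with | base h => exact h⟩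
  small := ⟨PEmpty, PEmpty.elim, fun i => i.elim, fun i => i.elim, fun _ _ _ => bot_le⟩

/-- Nilpotent ideals with a divided power structure on the underlying ideal of the underlying ring. -/
structure PDIdeal (P : HeartRing k H) where
  ideal : P.NilpotentIdeal
  pd : DividedPowers ideal.ideal.sections

/-- Inclusions compatible with the divided powers. -/
instance (P : HeartRing k H) : Preorder P.PDIdeal where
  le I J := I.ideal ≤ J.ideal ∧
    ∀ (n : ℕ), ∀ x ∈ I.ideal.ideal.sections, J.pd.dpow n x = I.pd.dpow n x
  le_refl I := ⟨le_rfl, fun _ _ _ => rfl⟩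
  le_trans I J K h₁ h₂ := ⟨h₁.1.trans h₂.1, fun n x hx =>
    (h₂.2 n x (h₁.1 NormedSet.point hx)).trans (h₁.2 n x hx)⟩

noncomputable def PDIdeal.zero (P : HeartRing k H) : P.PDIdeal :=
  ⟨NilpotentIdeal.zero P, dividedPowersBot P.Sections⟩

def PDIdeal.forget (P : HeartRing k H) : P.PDIdeal ⥤ P.NilpotentIdeal :=
  Monotone.functor (f := PDIdeal.ideal) fun _ _ h => h.1

end HeartRing

namespace SimplicialRing

open CategoryTheory.Limits

variable {k : BanachKind} {H : Type u} [NormedCommRing H] [BanachBase k H]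

/-- The functor of points `X = Spec B`, `X(R) = Map(B, R)`, through the simplicial enrichment. It is the
derived mapping space as `B` will be cofibrant and all `R` are fibrant (their points are simplicial
groups). -/
noncomputable def spec (B : SimplicialRing k H) : SimplicialRing k H ⥤ SSet.{u + 1} :=
  (SimplicialCategory.sHomFunctor (SimplicialRing k H)).obj (op B)

/-- The map of functors of points induced by `φ`. -/
noncomputable def specMap {A B : SimplicialRing k H} (φ : A ⟶ B) : spec B ⟶ spec A :=
  (SimplicialCategory.sHomFunctor (SimplicialRing k H)).map φ.op

/-- The diagram of the discrete algebras `π₀(R)/I`. -/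
noncomputable def nilpotentQuotients (R : SimplicialRing k H) :
    R.piZero.NilpotentIdeal ⥤ SimplicialRing k H where
  obj I := (SimplicialObject.const (HeartRing k H)).obj (R.piZero.quot I.ideal)
  map h := (SimplicialObject.const (HeartRing k H)).map (R.piZero.quotFactor h.le)
  map_id I := by
    rw [← (SimplicialObject.const (HeartRing k H)).map_id]
    congr 1
    refine HeartRing.Hom.ext (funext fun S => LinearMap.ext fun x => ?_)
    obtain ⟨x, rfl⟩ := Submodule.mkQ_surjective _ x
    rfl
  map_comp f g := by
    rw [← (SimplicialObject.const (HeartRing k H)).map_comp]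
    congr 1
    refine HeartRing.Hom.ext (funext fun S => LinearMap.ext fun x => ?_)
    obtain ⟨x, rfl⟩ := Submodule.mkQ_surjective _ x
    rfl

noncomputable def toNilpotentQuotients (R : SimplicialRing k H) :
    (Functor.const R.piZero.NilpotentIdeal).obj R ⟶ R.nilpotentQuotients where
  app I := R.toConst ≫ (SimplicialObject.const (HeartRing k H)).map (R.piZero.mkQuot I.ideal)
  naturality I J h := by
    refine (Category.id_comp _).trans (Eq.trans ?_ (Category.assoc _ _ _).symm)
    exact congrArg (fun t => R.toConst ≫ t)
      ((SimplicialObject.const (HeartRing k H)).map_comp (R.piZero.mkQuot I.ideal)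
        (R.piZero.quotFactor h.le))

section Completion

variable {A B : SimplicialRing k H} (φ : A ⟶ B) (R : SimplicialRing k H)
  {J : Type (u + 1)} [SmallCategory J] (F : J ⥤ R.piZero.NilpotentIdeal)

noncomputable def toReductions (A R : SimplicialRing k H) {J : Type (u + 1)} [SmallCategory J]
    (F : J ⥤ R.piZero.NilpotentIdeal) :
    (Functor.const J).obj ((spec A).obj R) ⟶ (F ⋙ R.nilpotentQuotients) ⋙ spec A where
  app j := (spec A).map (R.toNilpotentQuotients.app (F.obj j))
  naturality i j h := by
    refine (Category.id_comp _).trans ?_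
    change _ = _ ≫ (spec A).map _
    rw [← Functor.map_comp]
    exact congrArg (spec A).map ((Category.id_comp _).symm.trans (R.toNilpotentQuotients.naturality (F.map h)))

/-- The diagram `X(π₀(R)/I) ×_{Y(π₀(R)/I)} Y(R)`, homotopy fibre products, for `X = Spec B` and
`Y = Spec A`. -/
noncomputable def completionDiagram : J ⥤ SSet.{u + 1} :=
  homotopyPullback (Functor.whiskerLeft (F ⋙ R.nilpotentQuotients) (specMap φ))
    (toReductions A R F)

noncomputable def toCompletionDiagram :
    (Functor.const J).obj ((spec B).obj R) ⟶ completionDiagram φ R F :=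
  homotopyPullbackLift (toReductions B R F) ((Functor.const J).map ((specMap φ).app R)) (by
    ext j : 2
    exact (specMap φ).naturality (R.toNilpotentQuotients.app (F.obj j)))

/-- The colimit of `X(π₀(R)/I) ×_{Y(π₀(R)/I)} Y(R)`. -/
noncomputable def completion : SSet.{u + 1} := colimit (completionDiagram φ R F)

/-- The canonical map from `X(R)`, through the index `j`. -/
noncomputable def toCompletion (j : J) : (spec B).obj R ⟶ completion φ R F :=
  (toCompletionDiagram φ R F).app j ≫ colimit.ι (completionDiagram φ R F) j

end Completion

/-- The canonical map from `X(R)` to the formal completion `Y_{X,dR}(R)`, the colimit over all nilpotent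
ideals. -/
noncomputable def toFormalCompletion {A B : SimplicialRing k H} (φ : A ⟶ B)
    (R : SimplicialRing k H) :
    (spec B).obj R ⟶ completion φ R (𝟭 R.piZero.NilpotentIdeal) :=
  toCompletion φ R (𝟭 R.piZero.NilpotentIdeal) (HeartRing.NilpotentIdeal.zero R.piZero)

/-- The canonical map from `X(R)` to the PD completion `Y_{X,crys}(R)`, the colimit over all nilpotent
ideals with divided powers. -/
noncomputable def toPDCompletion {A B : SimplicialRing k H} (φ : A ⟶ B)
    (R : SimplicialRing k H) :
    (spec B).obj R ⟶ completion φ R (HeartRing.PDIdeal.forget R.piZero) :=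
  toCompletion φ R (HeartRing.PDIdeal.forget R.piZero) (HeartRing.PDIdeal.zero R.piZero)

/-- The levels of `R` are objects of the left heart. -/
def InLeftHeart (κ : IndKind) (R : SimplicialRing k H) : Prop :=
  ∀ n : ℕ, (R.level n).toHeartModule.InLeftHeart κ

/-- Trivial fibrations: trivial Kan fibrations on the points over every free module. -/
def IsTrivialFibration {R S : SimplicialRing k H} (p : R ⟶ S) : Prop :=
  ∀ T : NormedSet.{u}, SSet.modelCategoryQuillen.I.rlp
    (((SimplicialObject.whiskering _ _).obj (HeartRing.ptsFunctor k H T)).map p :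
      (_ : SSet.{u}) ⟶ _)

/-- Left lifting property of the initial morphism with respect to trivial fibrations. -/
def IsCofibrant (κ : IndKind) (A : SimplicialRing k H) : Prop :=
  ∀ ⦃R S : SimplicialRing k H⦄ (p : R ⟶ S), R.InLeftHeart κ → S.InLeftHeart κ →
    IsTrivialFibration p → ∀ g : A ⟶ S, ∃ h : A ⟶ R, h ≫ p = g

end SimplicialRing

/-- Affine stacks `Spec A`. The `∞`-category of simplicial commutative algebras is presented by its
cofibrant (and automatically fibrant) objects. -/
structure AffineStack (κ : IndKind) (k : BanachKind) (H : Type u) [NormedCommRing H]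
    [BanachBase k H] where
  ring : SimplicialRing k H
  heart : ring.InLeftHeart κ
  cofibrant : ring.IsCofibrant κ

namespace AffineStack

variable {κ : IndKind} {k : BanachKind} {H : Type u} [NormedCommRing H] [BanachBase k H]

/-- A morphism `Spec B ⟶ Spec A` is a homomorphism `A ⟶ B`. -/
instance : Category (AffineStack κ k H) where
  Hom X Y := Y.ring ⟶ X.ring
  id X := 𝟙 X.ring
  comp f g := g ≫ f

def ringMap {X Y : AffineStack κ k H} (f : X ⟶ Y) : Y.ring ⟶ X.ring := f

/-- De Rham intrinsic étale morphisms: affinoid, and `π₀(X(R)) ⟶ π₀(Y_{X,dR}(R))` is bijective for all `R`. -/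
def IsDeRhamEtale {X Y : AffineStack κ k H} (f : X ⟶ Y) : Prop :=
  SimplicialRing.IsAffinoid (ringMap f) ∧
    ∀ R : SimplicialRing k H, R.InLeftHeart κ →
      Function.Bijective (SSet.mapπ₀ (SimplicialRing.toFormalCompletion (ringMap f) R))

/-- PD intrinsic étale morphisms: affinoid, and `π₀(X(R)) ⟶ π₀(Y_{X,crys}(R))` is bijective for all `R`. -/
def IsPDEtale {X Y : AffineStack κ k H} (f : X ⟶ Y) : Prop :=
  SimplicialRing.IsAffinoid (ringMap f) ∧
    ∀ R : SimplicialRing k H, R.InLeftHeart κ →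
      Function.Bijective (SSet.mapπ₀ (SimplicialRing.toPDCompletion (ringMap f) R))

end AffineStack

end AnalyticStack

/-! The heart of the matter is that the de Rham condition is equivalent to a unique lifting property
on components, `HasUniqueLifting`: for a nilpotent ideal $I$ of $\pi_0(R)$, a component of
$X(\pi_0(R)/I)$ and a component of $Y(R)$ with the same image in $\pi_0(Y(\pi_0(R)/I))$ come from
exactly one component of $X(R)$. This property visibly composes, and it implies bijectivity for the
PD completion as well.

The translation rests on two facts. A discrete algebra has discrete mapping spaces into it
(`spec_const_isDiscrete`), so that $X(\pi_0(R)/I) \times_{Y(\pi_0(R)/I)} Y(R)$ is an ordinary fibre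
product and its components are the compatible pairs of components (`homotopyPullback_piZero`).
Moreover $\pi_0$ is a left adjoint, so it commutes with the colimit over the ideals.

From bijectivity to lifting (`hasUniqueLifting_of_bijective`): surjectivity for $R$ turns a
compatible pair $(x, z)$ into some $y$ over $z$, but $y$ is known to agree with $x$ only modulo a
larger nilpotent ideal $K$. The hypothesis is then used a second time, for the test algebra
$\pi_0(R)/I$ and the image of $K$ in it: injectivity there gives $y = x$ modulo $I$. This requires
$\pi_0(R)/I$ to be in the left heart, hence the bookkeeping with small subobjects.

From lifting to bijectivity (`HasUniqueLifting.bijective_toCompletion`): the index category may be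
arbitrary, as long as the chosen index maps to every other one. Equality in the colimit is tested by
mapping to $Y(R)$ and to the colimit of the $\pi_0(X(\pi_0(R)/K))$ over all nilpotent $K$, which is
filtered since sums of nilpotent ideals are nilpotent. So no directedness of the PD ideals enters,
only that the zero ideal is below all of them.

Affinoid morphisms compose by concatenating systems of variables and by transitivity of base change.
-/

namespace AnalyticStack

/-! ### Discrete simplicial sets and their path spaces. -/

section DiscreteSSet

open CategoryTheory.Limits MonoidalCategory Simplicial

/-- Simplicial sets all of whose simplices are degeneracies of vertices. -/
def IsDiscrete (Y : SSet.{u}) : Prop :=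
  ∀ (n : SimplexCategory) (y : Y.obj (op n)), ∃ y₀ : Y.obj (op (SimplexCategory.mk 0)),
    Y.map (SimplexCategory.const n (SimplexCategory.mk 0) 0).op y₀ = y

theorem map_op_map_op {Y : SSet.{u}} {a b c : SimplexCategory} (f : a ⟶ b) (g : b ⟶ c)
    (y : Y.obj (op c)) : Y.map f.op (Y.map g.op y) = Y.map (f ≫ g).op y := by
  rw [op_comp, Y.map_comp]
  rfl

/-- Both restrictions of a degenerate vertex are taken along the unique map to $[0]$. -/
theorem IsDiscrete.map_eq_map {Y : SSet.{u}} (hY : IsDiscrete Y) {m n : SimplexCategory}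
    (f g : m ⟶ n) (y : Y.obj (op n)) : Y.map f.op y = Y.map g.op y := by
  obtain ⟨y₀, rfl⟩ := hY n y
  rw [map_op_map_op, map_op_map_op]
  rfl

theorem IsDiscrete.map_injective {Y : SSet.{u}} (hY : IsDiscrete Y) {n : SimplexCategory}
    (f : SimplexCategory.mk 0 ⟶ n) : Function.Injective (Y.map f.op) := by
  intro y y' h
  obtain ⟨y₀, rfl⟩ := hY n y
  obtain ⟨y₁, rfl⟩ := hY n y'
  rw [map_op_map_op, map_op_map_op] at h
  have e : f ≫ SimplexCategory.const n (SimplexCategory.mk 0) 0 = 𝟙 _ := by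
    ext i
    fin_cases i
    rfl
  rw [e, op_id, Y.map_id] at h
  exact congrArg _ h

/-- Every edge has equal endpoints, so the identity on vertices descends to $\pi_0$ and is a left
inverse. -/
theorem IsDiscrete.mk_injective {Y : SSet.{u}} (hY : IsDiscrete Y) :
    Function.Injective (SSet.π₀.mk (X := Y)) := by
  intro y y' h
  exact congrArg (SSet.π₀.lift (X := Y) id fun a b e => by
    exact e.src_eq.symm.trans ((hY.map_eq_map _ _ e.edge).trans e.tgt_eq)) h

/-- Homotopies into a discrete target are constant. For a vertex `b` the homotopy traces an edge of
`Y`, whose endpoints agree; higher simplices of `Y` are determined by any one of their vertices. -/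
theorem IsDiscrete.app_eq_app {K Y : SSet.{u}} (hY : IsDiscrete Y)
    (f : SSet.stdSimplex.obj (SimplexCategory.mk 1) ⊗ K ⟶ Y) {n : SimplexCategory}
    (a a' : (SSet.stdSimplex.{u}.obj (SimplexCategory.mk 1)).obj (op n)) (b : K.obj (op n)) :
    f.app (op n) (a, b) = f.app (op n) (a', b) := by
  -- The vertex `(a, b)` is the face along `a` of the edge formed by the identity of $[1]$ and the
  -- degenerate edge at `b`.
  have vertex : ∀ (a : (SSet.stdSimplex.{u}.obj (SimplexCategory.mk 1)).obj
      (op (SimplexCategory.mk 0))) (b : K.obj (op (SimplexCategory.mk 0))),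
      f.app _ (a, b) = Y.map (SSet.stdSimplex.objEquiv a).op
        (f.app (op (SimplexCategory.mk 1)) (SSet.stdSimplex.objEquiv.symm (𝟙 _),
          K.map (SimplexCategory.const _ (SimplexCategory.mk 0) 0).op b)) := by
    intro a b
    refine Eq.trans ?_ (NatTrans.naturality_apply f (SSet.stdSimplex.objEquiv a).op _)
    congr 1
    refine Prod.ext ?_ ?_
    · exact SSet.stdSimplex.objEquiv.injective (Category.comp_id _).symm
    · refine Eq.trans ?_ (map_op_map_op _ _ b).symm
      have e : SSet.stdSimplex.objEquiv a ≫
          SimplexCategory.const _ (SimplexCategory.mk 0) 0 = 𝟙 _ := by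
        ext i
        fin_cases i
        rfl
      rw [e, op_id, K.map_id]
      rfl
  let v : SimplexCategory.mk 0 ⟶ n := SimplexCategory.const _ n 0
  refine hY.map_injective v ((NatTrans.naturality_apply f v.op _).symm.trans
    (Eq.trans ?_ (NatTrans.naturality_apply f v.op _)))
  exact (vertex _ _).trans ((hY.map_eq_map _ _ _).trans (vertex _ _).symm)

theorem IsDiscrete.hom_ext_of_vertexInclusion {K Y : SSet.{u}} (hY : IsDiscrete Y)
    {f g : SSet.stdSimplex.obj (SimplexCategory.mk 1) ⊗ K ⟶ Y}
    (h : vertexInclusion 0 K ≫ f = vertexInclusion 0 K ≫ g) : f = g := by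
  ext n ⟨a, b⟩
  have h' := ConcreteCategory.congr_hom (NatTrans.congr_app h n) b
  exact (hY.app_eq_app f _ _ b).trans (h'.trans (hY.app_eq_app g _ _ b))

/-- With `constantPath_endpoint` this makes evaluation an isomorphism from the path space to `Y`.
After transposition both sides are homotopies into `Y`, so it suffices to compare them at the vertex
0. -/
theorem IsDiscrete.endpoint_comp_constantPath {Y : SSet.{u}} (hY : IsDiscrete Y) :
    (endpoint 0).app Y ≫ constantPath.app Y = 𝟙 (pathFunctor.obj Y) := by
  refine MonoidalClosed.uncurry_injective (hY.hom_ext_of_vertexInclusion ?_)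
  have e : constantPath.app Y ≫ (endpoint 0).app Y = 𝟙 Y :=
    NatTrans.congr_app (constantPath_endpoint 0) Y
  have h : ∀ t : pathFunctor.obj Y ⟶ pathFunctor.obj Y,
      vertexInclusion 0 _ ≫ MonoidalClosed.uncurry t = t ≫ (endpoint 0).app Y := fun t => by
    rw [MonoidalClosed.uncurry_eq]
    rfl
  rw [h, h, Category.id_comp, Category.assoc, e]
  exact Category.comp_id _

/-- Both evaluations are inverse to the same isomorphism `constantPath`. -/
theorem IsDiscrete.endpoint_eq {Y : SSet.{u}} (hY : IsDiscrete Y) :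
    (endpoint 0).app Y = (endpoint 1).app Y := by
  have e : constantPath.app Y ≫ (endpoint 1).app Y = 𝟙 Y :=
    NatTrans.congr_app (constantPath_endpoint 1) Y
  calc (endpoint 0).app Y = (endpoint 0).app Y ≫ constantPath.app Y ≫ (endpoint 1).app Y := by
        rw [e]; exact (Category.comp_id _).symm
    _ = _ := by
      rw [← Category.assoc, hY.endpoint_comp_constantPath]
      exact Category.id_comp _

/-! ### Homotopy fibre products over a discrete base are strict. -/

section Pullback

section General

variable {C : Type*} [Category* C] [HasPullbacks C] [HasBinaryProducts C] {X Y Z E : C}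
  (p : X ⟶ Y) (q : Z ⟶ Y) (e : E ⟶ Y) (c : Y ⟶ E)

theorem pullback_prod_lift_self_w :
    (pullback.fst (prod.map p q) (prod.lift e e) ≫ prod.fst) ≫ p =
      pullback.snd (prod.map p q) (prod.lift e e) ≫ e := by
  have h := congrArg (fun t => t ≫ prod.fst)
    (pullback.condition (f := prod.map p q) (g := prod.lift e e))
  simp only [Category.assoc] at h ⊢
  rwa [prod.map_fst, prod.lift_fst] at h

theorem pullback_prod_lift_self_w' :
    (pullback.fst (prod.map p q) (prod.lift e e) ≫ prod.snd) ≫ q =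
      pullback.snd (prod.map p q) (prod.lift e e) ≫ e := by
  have h := congrArg (fun t => t ≫ prod.snd)
    (pullback.condition (f := prod.map p q) (g := prod.lift e e))
  simp only [Category.assoc] at h ⊢
  rwa [prod.map_snd, prod.lift_snd] at h

/-- The fibre product over the diagonal, up to an isomorphism `e`, is the fibre product. -/
theorem isPullback_of_prod_lift_self {e' : E ⟶ Y} (he : e' = e) (h₁ : e ≫ c = 𝟙 E)
    (h₂ : c ≫ e = 𝟙 Y) :
    IsPullback (pullback.fst (prod.map p q) (prod.lift e e') ≫ prod.fst)
      (pullback.fst (prod.map p q) (prod.lift e e') ≫ prod.snd) p q := by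
  subst he
  refine ⟨⟨(pullback_prod_lift_self_w p q e').trans (pullback_prod_lift_self_w' p q e').symm⟩,
    ⟨PullbackCone.IsLimit.mk _
    -- The coordinate in `E` is forced: it is the image under `c` of the common value in `Y`.
    (fun s => pullback.lift (prod.lift s.fst s.snd) ((s.fst ≫ p) ≫ c) ?_)
      (fun s => ?_) (fun s => ?_) (fun s m hm₁ hm₂ => ?_)⟩⟩
  · rw [prod.lift_map, prod.comp_lift, Category.assoc, h₂, Category.comp_id, s.condition]
  · rw [← Category.assoc, pullback.lift_fst, prod.lift_fst]
  · rw [← Category.assoc, pullback.lift_fst, prod.lift_snd]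
  · refine pullback.hom_ext (prod.hom_ext ?_ ?_) ?_
    · rw [pullback.lift_fst, prod.lift_fst, Category.assoc, hm₁]
    · rw [pullback.lift_fst, prod.lift_snd, Category.assoc, hm₂]
    · have h := congrArg (fun t => m ≫ t ≫ c) (pullback_prod_lift_self_w p q e')
      simp only [Category.assoc, h₁, Category.comp_id] at h hm₁ hm₂
      rw [pullback.lift_snd, ← h, ← hm₁]
      simp only [Category.assoc]

end General

variable {J : Type*} [Category* J] {X Y Z : J ⥤ SSet.{u}} (p : X ⟶ Y) (q : Z ⟶ Y)

noncomputable def homotopyPullbackFst : homotopyPullback p q ⟶ X :=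
  pullback.fst (prod.map p q) (prod.lift (Functor.whiskerLeft Y (endpoint 0))
    (Functor.whiskerLeft Y (endpoint 1))) ≫ prod.fst

noncomputable def homotopyPullbackSnd : homotopyPullback p q ⟶ Z :=
  pullback.fst (prod.map p q) (prod.lift (Functor.whiskerLeft Y (endpoint 0))
    (Functor.whiskerLeft Y (endpoint 1))) ≫ prod.snd

/-- For a discrete base, the homotopy fibre product is the fibre product. -/
theorem homotopyPullback_isPullback (hY : ∀ j, IsDiscrete (Y.obj j)) :
    IsPullback (homotopyPullbackFst p q) (homotopyPullbackSnd p q) p q := by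
  have e : Functor.whiskerLeft Y (endpoint 1) = Functor.whiskerLeft Y (endpoint 0) := by
    ext j : 2
    exact (hY j).endpoint_eq.symm
  unfold homotopyPullbackFst homotopyPullbackSnd homotopyPullback
  refine isPullback_of_prod_lift_self p q _ (Functor.whiskerLeft Y constantPath) e ?_ ?_
  · ext j : 2
    exact (hY j).endpoint_comp_constantPath
  · ext j : 2
    exact NatTrans.congr_app (constantPath_endpoint 0) (Y.obj j)

theorem homotopyPullbackLift_fst {W : J ⥤ SSet.{u}} {p : X ⟶ Y} {q : Z ⟶ Y} (a : W ⟶ X)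
    (b : W ⟶ Z) (h : a ≫ p = b ≫ q) :
    homotopyPullbackLift a b h ≫ homotopyPullbackFst p q = a :=
  (Category.assoc _ _ _).symm.trans
    ((congrArg (fun t => t ≫ prod.fst) (pullback.lift_fst _ _ _)).trans (prod.lift_fst _ _))

theorem homotopyPullbackLift_snd {W : J ⥤ SSet.{u}} {p : X ⟶ Y} {q : Z ⟶ Y} (a : W ⟶ X)
    (b : W ⟶ Z) (h : a ≫ p = b ≫ q) :
    homotopyPullbackLift a b h ≫ homotopyPullbackSnd p q = b :=
  (Category.assoc _ _ _).symm.trans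
    ((congrArg (fun t => t ≫ prod.snd) (pullback.lift_fst _ _ _)).trans (prod.lift_snd _ _))

variable {p q}

theorem homotopyPullback_exists (hY : ∀ j, IsDiscrete (Y.obj j)) (j : J) (n : SimplexCategoryᵒᵖ)
    (x : ((X.obj j).obj n)) (z : (Z.obj j).obj n)
    (h : (p.app j).app n x = (q.app j).app n z) :
    ∃ d : ((homotopyPullback p q).obj j).obj n, ((homotopyPullbackFst p q).app j).app n d = x ∧
      ((homotopyPullbackSnd p q).app j).app n d = z :=
  Types.exists_of_isPullback (((homotopyPullback_isPullback p q hY).map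
    ((evaluation J SSet.{u}).obj j)).map ((evaluation _ (Type u)).obj n)) x z h

theorem homotopyPullback_ext (hY : ∀ j, IsDiscrete (Y.obj j)) (j : J) (n : SimplexCategoryᵒᵖ)
    {d d' : ((homotopyPullback p q).obj j).obj n}
    (h₁ : ((homotopyPullbackFst p q).app j).app n d = ((homotopyPullbackFst p q).app j).app n d')
    (h₂ : ((homotopyPullbackSnd p q).app j).app n d = ((homotopyPullbackSnd p q).app j).app n d') :
    d = d' :=
  Types.ext_of_isPullback (((homotopyPullback_isPullback p q hY).map
    ((evaluation J SSet.{u}).obj j)).map ((evaluation _ (Type u)).obj n)) h₁ h₂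

end Pullback

/-- Components of the homotopy fibre product of discrete `X` and arbitrary `Z` over a discrete base. -/
theorem homotopyPullback_piZero {J : Type*} [Category* J] {X Y Z : J ⥤ SSet.{u}} {p : X ⟶ Y}
    {q : Z ⟶ Y} (hX : ∀ j, IsDiscrete (X.obj j)) (hY : ∀ j, IsDiscrete (Y.obj j)) (j : J)
    (x : SSet.π₀ (X.obj j)) (z : SSet.π₀ (Z.obj j))
    (h : SSet.mapπ₀ (p.app j) x = SSet.mapπ₀ (q.app j) z) :
    ∃! d : SSet.π₀ ((homotopyPullback p q).obj j),
      SSet.mapπ₀ ((homotopyPullbackFst p q).app j) d = x ∧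
        SSet.mapπ₀ ((homotopyPullbackSnd p q).app j) d = z := by
  obtain ⟨x, rfl⟩ := SSet.π₀.mk_surjective x
  obtain ⟨z, rfl⟩ := SSet.π₀.mk_surjective z
  -- Discreteness of the base turns equality of components into equality of vertices, so the given
  -- representatives are already compatible.
  obtain ⟨d, h₁, h₂⟩ := homotopyPullback_exists hY j _ x z ((hY j).mk_injective h)
  refine ⟨SSet.π₀.mk d, ⟨congrArg SSet.π₀.mk h₁, congrArg SSet.π₀.mk h₂⟩, ?_⟩
  -- Induction along a zigzag of edges in `Z`, with the vertex `x` fixed. The equivalence is carried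
  -- along because each intermediate vertex must also be compatible with `x`, in order to lift to
  -- the fibre product.
  have key : ∀ {z z' : (Z.obj j).obj (op (SimplexCategory.mk 0))}, Relation.EqvGen SSet.π₀Rel z z' →
      ((p.app j).app _ x = (q.app j).app _ z ↔ (p.app j).app _ x = (q.app j).app _ z') ∧
      ∀ d d' : ((homotopyPullback p q).obj j).obj (op (SimplexCategory.mk 0)),
        ((homotopyPullbackFst p q).app j).app _ d = x →
        ((homotopyPullbackSnd p q).app j).app _ d = z →
        ((homotopyPullbackFst p q).app j).app _ d' = x →
        ((homotopyPullbackSnd p q).app j).app _ d' = z' → SSet.π₀.mk d = SSet.π₀.mk d' := by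
    intro z z' hz
    induction hz with
    | rel z z' e =>
      obtain ⟨e⟩ := e
      have hq : (q.app j).app _ z = (q.app j).app _ z' :=
        (hY j).mk_injective (SSet.π₀.sound (e.map (q.app j)))
      refine ⟨by rw [hq], fun d d' h₁ h₂ h₁' h₂' => ?_⟩
      have hc : (p.app j).app _ x = (q.app j).app _ z := by
        rw [← h₁, ← h₂]
        exact ConcreteCategory.congr_hom (NatTrans.congr_app (NatTrans.congr_app
          (homotopyPullback_isPullback p q hY).w j) _) d
      -- The edge of `Z` is paired with the degenerate edge at `x`; they agree in `Y` because they
      -- agree at the source and `Y` is discrete.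
      let s : (X.obj j).obj (op (SimplexCategory.mk 1)) :=
        (X.obj j).map (SimplexCategory.const _ (SimplexCategory.mk 0) 0).op x
      have hs : ∀ f : SimplexCategory.mk 0 ⟶ SimplexCategory.mk 1,
          (X.obj j).map f.op s = x := fun f => by
        refine (map_op_map_op _ _ x).trans ?_
        have e : f ≫ SimplexCategory.const _ (SimplexCategory.mk 0) 0 = 𝟙 _ := by
          ext i
          fin_cases i
          rfl
        rw [e, op_id, (X.obj j).map_id]
        rfl
      obtain ⟨b, hb₁, hb₂⟩ := homotopyPullback_exists (p := p) (q := q) hY j _ s e.edge (by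
        refine (hY j).map_injective (SimplexCategory.δ 1) ?_
        refine (NatTrans.naturality_apply (p.app j) _ _).symm.trans (Eq.trans ?_
          (NatTrans.naturality_apply (q.app j) _ _))
        exact (congrArg _ (hs _)).trans (hc.trans (congrArg _ e.src_eq.symm)))
      refine SSet.π₀.sound (SSet.Edge.mk b ?_ ?_)
      · refine homotopyPullback_ext hY j _ ?_ ?_
        · exact (NatTrans.naturality_apply ((homotopyPullbackFst p q).app j) _ b).trans
            ((congrArg _ hb₁).trans ((hs _).trans h₁.symm))
        · exact (NatTrans.naturality_apply ((homotopyPullbackSnd p q).app j) _ b).trans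
            ((congrArg _ hb₂).trans (e.src_eq.trans h₂.symm))
      · refine homotopyPullback_ext hY j _ ?_ ?_
        · exact (NatTrans.naturality_apply ((homotopyPullbackFst p q).app j) _ b).trans
            ((congrArg _ hb₁).trans ((hs _).trans h₁'.symm))
        · exact (NatTrans.naturality_apply ((homotopyPullbackSnd p q).app j) _ b).trans
            ((congrArg _ hb₂).trans (e.tgt_eq.trans h₂'.symm))
    | refl z => exact ⟨Iff.rfl, fun d d' h₁ h₂ h₁' h₂' => congrArg _
        (homotopyPullback_ext hY j _ (h₁.trans h₁'.symm) (h₂.trans h₂'.symm))⟩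
    | symm z z' _ ih => exact ⟨ih.1.symm, fun d d' h₁ h₂ h₁' h₂' =>
        (ih.2 d' d h₁' h₂' h₁ h₂).symm⟩
    | trans z z' z'' _ _ ih ih' =>
      refine ⟨ih.1.trans ih'.1, fun d d' h₁ h₂ h₁' h₂' => ?_⟩
      have hc : (p.app j).app _ x = (q.app j).app _ z' := by
        refine ih.1.1 ?_
        rw [← h₁, ← h₂]
        exact ConcreteCategory.congr_hom (NatTrans.congr_app (NatTrans.congr_app
          (homotopyPullback_isPullback p q hY).w j) _) d
      obtain ⟨b, hb₁, hb₂⟩ := homotopyPullback_exists hY j _ x z' hc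
      exact (ih.2 d b h₁ h₂ hb₁ hb₂).trans (ih'.2 b d' hb₁ hb₂ h₁' h₂')
  rintro d' ⟨h₁', h₂'⟩
  obtain ⟨d', rfl⟩ := SSet.π₀.mk_surjective d'
  -- Discreteness of `X` makes the first coordinate of `d'` equal to `x` as a vertex, which is why
  -- `x` could be fixed above.
  exact (key ((SSet.π₀.mk_eq_mk_iff _ _).1 h₂')).2 d' d ((hX j).mk_injective h₁') rfl h₁ h₂

theorem homotopyPullback_piZero_condition {J : Type*} [Category* J] {X Y Z : J ⥤ SSet.{u}} {p : X ⟶ Y}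
    {q : Z ⟶ Y} (hY : ∀ j, IsDiscrete (Y.obj j)) (j : J)
    (d : SSet.π₀ ((homotopyPullback p q).obj j)) :
    SSet.mapπ₀ (p.app j) (SSet.mapπ₀ ((homotopyPullbackFst p q).app j) d) =
      SSet.mapπ₀ (q.app j) (SSet.mapπ₀ ((homotopyPullbackSnd p q).app j) d) := by
  rw [← SSet.mapπ₀_comp_apply, ← SSet.mapπ₀_comp_apply, ← NatTrans.comp_app, ← NatTrans.comp_app,
    (homotopyPullback_isPullback p q hY).w]

/-! ### Connected components and colimits. -/

/-- All vertices of a simplex lie in the same component. -/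
theorem piZero_mk_vertex {X : SSet.{u}} {n : SimplexCategory} (v w : SimplexCategory.mk 0 ⟶ n)
    (x : X.obj (op n)) : SSet.π₀.mk (X.map v.op x) = SSet.π₀.mk (X.map w.op x) := by
  have key : ∀ v : SimplexCategory.mk 0 ⟶ n,
      SSet.π₀.mk (X.map (SimplexCategory.const _ n 0).op x) = SSet.π₀.mk (X.map v.op x) := by
    intro v
    let e : SimplexCategory.mk 1 ⟶ n :=
      SimplexCategory.mkOfLe (n := n.len) 0 (v.toOrderHom 0) (Fin.zero_le _)
    have h0 : SimplexCategory.δ 0 ≫ e = v := by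
      ext i
      fin_cases i
      rfl
    have h1 : SimplexCategory.δ 1 ≫ e = SimplexCategory.const _ n 0 := by
      ext i
      fin_cases i
      rfl
    rw [← h0, ← h1, ← map_op_map_op, ← map_op_map_op]
    exact SSet.π₀.sound (SSet.Edge.mk' _)
  exact (key v).symm.trans (key w)

/-- The functor of connected components is left adjoint to the functor of constant simplicial sets. -/
def piZeroAdjunction : SSet.π₀Functor.{u} ⊣ Functor.const SimplexCategoryᵒᵖ :=
  Adjunction.mkOfHomEquiv
    { homEquiv := fun X T =>
        { toFun := fun g =>
            { app := fun n => ↾fun x => g (SSet.π₀.mk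
                (X.map (SimplexCategory.const (SimplexCategory.mk 0) n.unop 0).op x))
              naturality := fun m n f => by
                ext x
                refine congrArg g ?_
                change SSet.π₀.mk (X.map _ (X.map f.unop.op x)) = _
                rw [map_op_map_op]
                exact piZero_mk_vertex _ _ x }
          invFun := fun f => ↾SSet.π₀.lift (fun x => f.app _ x) (fun x y e =>
            (congrArg (f.app _) e.src_eq).symm.trans
              ((NatTrans.naturality_apply f (SimplexCategory.δ 1).op e.edge).trans
                ((NatTrans.naturality_apply f (SimplexCategory.δ 0).op e.edge).symm.trans
                  (congrArg (f.app _) e.tgt_eq))))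
          left_inv := fun g => by
            ext x
            obtain ⟨x, rfl⟩ := SSet.π₀.mk_surjective x
            refine congrArg (fun t => g (SSet.π₀.mk t)) ?_
            have e : SimplexCategory.const (SimplexCategory.mk 0) (SimplexCategory.mk 0) 0 =
                𝟙 _ := Subsingleton.elim _ _
            rw [e, op_id, X.map_id]
            rfl
          right_inv := fun f => by
            ext n x
            exact NatTrans.naturality_apply f _ x }
      homEquiv_naturality_left_symm := fun f g => by
        ext x
        obtain ⟨x, rfl⟩ := SSet.π₀.mk_surjective x
        rfl
      homEquiv_naturality_right := fun f g => rfl }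

/-- Connected components of a colimit. -/
noncomputable def isColimitPiZero {J : Type u} [SmallCategory J] (D : J ⥤ SSet.{u}) :
    IsColimit (SSet.π₀Functor.mapCocone (colimit.cocone D)) :=
  haveI := piZeroAdjunction.{u}.leftAdjoint_preservesColimits
  isColimitOfPreserves SSet.π₀Functor (colimit.isColimit D)

end DiscreteSSet

/-! ### Mapping spaces into discrete algebras. -/

namespace SimplicialRing

variable {k : BanachKind} {H : Type u} [NormedCommRing H] [BanachBase k H]

/-- An $n$-simplex is a natural family of maps $B_m \to P$ indexed by the maps $[m] \to [n]$. As the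
target is constant, naturality forces the family to be independent of the index map, so the simplex
is a degenerate vertex. -/
theorem spec_const_isDiscrete (B : SimplicialRing k H) (P : HeartRing k H) :
    IsDiscrete ((spec B).obj ((SimplicialObject.const (HeartRing k H)).obj P)) := by
  intro n y
  let v : SimplexCategory.mk 0 ⟶ n := SimplexCategory.const _ n 0
  refine ⟨((spec B).obj _).map v.op y, ?_⟩
  let y' : Functor.HomObj B ((SimplicialObject.const (HeartRing k H)).obj P)
    (coyoneda.obj (op (op n))) := y
  have edge : ∀ u : SimplexCategory.mk 0 ⟶ n, y'.app _ u.op = y'.app _ v.op := fun u => by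
    let e : SimplexCategory.mk 1 ⟶ n :=
      SimplexCategory.mkOfLe (n := n.len) 0 (u.toOrderHom 0) (Fin.zero_le _)
    have h0 : SimplexCategory.δ 0 ≫ e = u := by
      ext i
      fin_cases i
      rfl
    have h1 : SimplexCategory.δ 1 ≫ e = v := by
      ext i
      fin_cases i
      rfl
    have n0 : B.map (SimplexCategory.δ 0).op ≫ y'.app _ (SimplexCategory.δ 0 ≫ e).op =
        y'.app _ e.op ≫ 𝟙 _ := y'.naturality (SimplexCategory.δ 0).op e.op
    have n1 : B.map (SimplexCategory.δ 1).op ≫ y'.app _ (SimplexCategory.δ 1 ≫ e).op =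
        y'.app _ e.op ≫ 𝟙 _ := y'.naturality (SimplexCategory.δ 1).op e.op
    -- The maps at the two ends of an edge agree after composition with the respective faces of `B`;
    -- the degeneracy is a common section of both faces and cancels them.
    have h := congrArg (fun t => B.map (SimplexCategory.σ 0).op ≫ t) (n0.trans n1.symm)
    have e0 : B.map (SimplexCategory.σ 0).op ≫ B.map (SimplexCategory.δ (n := 0) 0).op = 𝟙 _ := by
      rw [← B.map_comp, ← op_comp, SimplexCategory.δ_comp_σ_self' (by rfl), op_id, B.map_id]
    have e1 : B.map (SimplexCategory.σ 0).op ≫ B.map (SimplexCategory.δ (n := 0) 1).op = 𝟙 _ := by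
      rw [← B.map_comp, ← op_comp, SimplexCategory.δ_comp_σ_succ' (by rfl), op_id, B.map_id]
    simp only [← Category.assoc] at h
    rw [e0, e1, h0, h1] at h
    exact (Category.id_comp _).symm.trans (h.trans (Category.id_comp _))
  -- Naturality along a vertex of $[m]$ expresses the value at any index map through a value at a
  -- vertex.
  have const : ∀ {m : SimplexCategory} (u w : m ⟶ n), y'.app (op m) u.op = y'.app (op m) w.op := by
    intro m u w
    let t : SimplexCategory.mk 0 ⟶ m := SimplexCategory.const _ m 0
    have nu : B.map t.op ≫ y'.app _ (t ≫ u).op = y'.app _ u.op ≫ 𝟙 _ := y'.naturality t.op u.op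
    have nw : B.map t.op ≫ y'.app _ (t ≫ w).op = y'.app _ w.op ≫ 𝟙 _ := y'.naturality t.op w.op
    rw [edge] at nu nw
    exact (Category.comp_id _).symm.trans (nu.symm.trans (nw.trans (Category.comp_id _)))
  refine Functor.functorHom_ext fun m f => ?_
  exact const (m := m.unop) _ _

end SimplicialRing
end AnalyticStack

namespace AnalyticStack

variable {k : BanachKind} {H : Type u} [NormedCommRing H] [BanachBase k H]

/-! ### Small subobjects and quotients in the left heart. -/

namespace HeartModule

/-- The preimage of a subobject. -/
def Sub.comap {M N : HeartModule k H} (f : Hom M N) (L : Sub N) : Sub M where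
  carrier S := (L.carrier S).comap (f.app S)
  map_mem u x hx := by
    rw [Submodule.mem_comap] at hx ⊢
    rw [f.naturality]
    exact L.map_mem u hx

/-- The image of a subobject. -/
def Sub.image {M N : HeartModule k H} (f : Hom M N) (L : Sub M) : Sub N where
  carrier S := (L.carrier S).map (f.app S)
  map_mem := by
    rintro S T u _ ⟨x, hx, rfl⟩
    exact ⟨M.map u x, L.map_mem u hx, f.naturality u x⟩

instance (M : HeartModule k H) : OrderTop (Sub M) where
  top := { carrier := fun _ => ⊤, map_mem := fun _ _ _ => trivial }
  le_top _ := fun _ _ _ => trivial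

theorem Sub.IsSmall.image {M N : HeartModule k H} (f : Hom M N) {L : Sub M} (hL : L.IsSmall) :
    (L.image f).IsSmall := by
  obtain ⟨ι, S, x, hx, hmin⟩ := hL
  refine ⟨ι, S, fun i => f.app _ (x i), fun i => ⟨x i, hx i, rfl⟩, fun N' hN' T => ?_⟩
  rintro _ ⟨y, hy, rfl⟩
  exact hmin (N'.comap f) hN' T hy

theorem Sub.IsSmall.of_le_image {M N : HeartModule k H} (f : Hom M N) {L : Sub M} {L' : Sub N}
    (hL : L.IsSmall) (h : L' = L.image f) : L'.IsSmall :=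
  h ▸ hL.image f

/-- An extension of small subobjects is small. -/
theorem Sub.IsSmall.comap {M N : HeartModule k H} {f : Hom M N}
    (hf : ∀ S, Function.Surjective (f.app S)) (hk : f.ker.IsSmall) {L : Sub N} (hL : L.IsSmall) :
    (L.comap f).IsSmall := by
  obtain ⟨ι, S, x, hx, hmin⟩ := hk
  obtain ⟨ι', S', y, hy, hmin'⟩ := hL
  choose z hz using fun i => hf (S' i) (y i)
  refine ⟨ι ⊕ ι', Sum.elim S S', fun i => match i with | .inl i => x i | .inr i => z i, ?_, ?_⟩
  · rintro (i | i)
    · have h : f.app _ (x i) = 0 := hx i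
      change f.app _ (x i) ∈ L.carrier _
      rw [h]
      exact Submodule.zero_mem _
    · change f.app _ (z i) ∈ L.carrier _
      rw [hz]
      exact hy i
  · intro N' hN' T w hw
    have hker : f.ker ≤ N' := hmin N' fun i => hN' (.inl i)
    obtain ⟨w', hw', e⟩ := hmin' (N'.image f) (fun i => ⟨z i, hN' (.inr i), hz i⟩) T hw
    -- The generators of `L` provide a point `w'` of `N'` with the same image as `w`; the generators
    -- of the kernel absorb the difference.
    have hd : w - w' ∈ N'.carrier T := hker T (by
      change f.app T (w - w') = 0
      rw [map_sub, e, sub_self])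
    simpa using (N'.carrier T).add_mem hd hw'

/-- The tautological normed set of a Banach module: its nonzero elements. -/
def unitFamily (V : BanachModule k H) : NormedSet.{u} where
  carrier := {v : V.carrier // v ≠ 0}
  weight v := ⟨‖v.1‖, norm_pos_iff.2 v.2⟩

noncomputable def unitFamilyMap (V : BanachModule k H) :
    BoundedHom ((unitFamily V).free k H) V :=
  (unitFamily V).lift (fun v => v.1) ⟨1, fun v => (one_mul ‖v.1‖).ge⟩

/-- Every bounded map from a free module factors through the tautological one. -/
theorem exists_comp_unitFamilyMap {V : BanachModule k H} {S : NormedSet.{u}}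
    (f : BoundedHom (S.free k H) V) :
    ∃ g : BoundedHom (S.free k H) ((unitFamily V).free k H),
      BoundedHom.comp (unitFamilyMap V) g = f := by
  classical
  obtain ⟨C, hC⟩ := f.2
  let w : S.carrier → ((unitFamily V).free k H).carrier := fun s =>
    if h : f.1 (S.basis s) = 0 then 0 else (unitFamily V).basis ⟨f.1 (S.basis s), h⟩
  have hw : ∃ C : ℝ, ∀ s, ‖w s‖ ≤ C * (S.weight s).1 := by
    -- The norm of $1$ need not be one and enters twice: through the basis vector to which `f` is
    -- applied, and through the basis vector chosen as its lift.
    refine ⟨|C| * ‖(1 : H)‖ * ‖(1 : H)‖, fun s => ?_⟩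
    by_cases h : f.1 (S.basis s) = 0
    · simp only [w, dif_pos h, norm_zero]
      have := (S.weight s).2.le
      positivity
    · simp only [w, dif_neg h]
      refine (NormedSet.norm_basis (k := k) (H := H) (unitFamily V) _).le.trans ?_
      have h1 : ‖f.1 (S.basis s)‖ ≤ |C| * ((S.weight s).1 * ‖(1 : H)‖) := by
        rw [← NormedSet.norm_basis (k := k) (H := H)]
        exact (hC _).trans (mul_le_mul_of_nonneg_right (le_abs_self C) (norm_nonneg _))
      change ‖f.1 (S.basis s)‖ * _ ≤ _
      calc _ ≤ |C| * ((S.weight s).1 * ‖(1 : H)‖) * ‖(1 : H)‖ :=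
            mul_le_mul_of_nonneg_right h1 (norm_nonneg _)
        _ = _ := by ring
  refine ⟨S.lift w hw, NormedSet.hom_ext fun s => ?_⟩
  rw [BoundedHom.comp_apply, NormedSet.lift_basis]
  by_cases h : f.1 (S.basis s) = 0
  · simp only [w, dif_pos h, h, map_zero]
  · simp only [w, dif_neg h]
    exact NormedSet.lift_basis _ _ _ _

/-- One tautological point for each index of the small diagram suffices: every point comes from some
`V j`, and hence is a pullback of the tautological point of `V j`. -/
theorem IsIndBanach.isSmall_top {κ : IndKind} {M : HeartModule k H} (hM : M.IsIndBanach κ) :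
    (⊤ : Sub M).IsSmall := by
  obtain ⟨p⟩ := hM
  let _ := p.category
  refine ⟨p.J, fun j => unitFamily (p.V.obj j), fun j => p.ι j _ (unitFamilyMap _),
    fun _ => trivial, fun N' hN' S x _ => ?_⟩
  obtain ⟨j, v, rfl⟩ := p.exists_rep S x
  obtain ⟨g, rfl⟩ := exists_comp_unitFamilyMap v
  rw [p.ι_naturality]
  exact N'.map_mem g (hN' j)

theorem InLeftHeart.isSmall_top {κ : IndKind} {M : HeartModule k H} (hM : M.InLeftHeart κ) :
    (⊤ : Sub M).IsSmall := by
  obtain ⟨N, π, hN, hπ, -⟩ := hM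
  refine hN.isSmall_top.of_le_image π (Sub.ext (funext fun S => ?_))
  exact (Submodule.eq_top_iff'.2 fun x => by
    obtain ⟨y, rfl⟩ := hπ S x
    exact ⟨y, trivial, rfl⟩).symm

/-- Quotients by small subobjects. -/
theorem InLeftHeart.of_surjective {κ : IndKind} {M M' : HeartModule k H} (hM : M.InLeftHeart κ)
    (ρ : Hom M M') (hρ : ∀ S, Function.Surjective (ρ.app S)) (hk : ρ.ker.IsSmall) :
    M'.InLeftHeart κ := by
  obtain ⟨N, π, hN, hπ, hπk⟩ := hM
  exact ⟨N, ρ.comp π, hN, fun S => (hρ S).comp (hπ S), Sub.IsSmall.comap hπ hπk hk⟩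

end HeartModule

/-! ### Images and sums of nilpotent ideals. -/

namespace HeartRing

theorem quot_inLeftHeart {κ : IndKind} (P : HeartRing k H) (I : IdealObj P)
    (hP : P.toHeartModule.InLeftHeart κ) (hI : I.toSub.IsSmall) :
    (P.quot I).toHeartModule.InLeftHeart κ := by
  refine hP.of_surjective (P.mkQuot I).toHom (fun S => Submodule.mkQ_surjective _) ?_
  have e : (P.mkQuot I).toHom.ker = I.toSub :=
    HeartModule.Sub.ext (funext fun S => Submodule.ker_mkQ (I.carrier S))
  rwa [e]

namespace IdealObj

variable {A A' : HeartRing k H}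

/-- The image of an ideal under a surjection. -/
def image (f : A ⟶ A') (hf : ∀ S, Function.Surjective (app f S)) (I : IdealObj A) :
    IdealObj A' where
  toSub := I.toSub.image (Hom.toHom f)
  mul_mem := by
    rintro S T a _ ⟨x, hx, rfl⟩
    -- Surjectivity enters here: the image is an ideal because scalars can be lifted.
    obtain ⟨a, rfl⟩ := hf S a
    exact ⟨A.mul a x, I.mul_mem a hx, app_mul f a x⟩

theorem IsPowerProduct.of_image {f : A ⟶ A'} {hf : ∀ S, Function.Surjective (app f S)}
    {I : IdealObj A} {n : ℕ} {S : NormedSet.{u}} {y : A'.pts S}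
    (h : IsPowerProduct (I.image f hf) n S y) : ∃ x, IsPowerProduct I n S x ∧ app f S x = y := by
  induction h with
  | base h =>
    obtain ⟨x, hx, rfl⟩ := h
    exact ⟨x, .base hx, rfl⟩
  | step _ h ih =>
    obtain ⟨x, hx, rfl⟩ := ih
    obtain ⟨y, hy, rfl⟩ := h
    exact ⟨A.mul x y, .step hx hy, app_mul f x y⟩

theorem IsNilpotent.image {f : A ⟶ A'} {hf : ∀ S, Function.Surjective (app f S)}
    {I : IdealObj A} (hI : I.IsNilpotent) : (I.image f hf).IsNilpotent := by
  obtain ⟨n, hn⟩ := hI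
  refine ⟨n, fun S y hy => ?_⟩
  obtain ⟨x, hx, rfl⟩ := hy.of_image
  rw [hn S x hx, map_zero]

/-- The sum of two ideals. -/
def sum (I J : IdealObj A) : IdealObj A where
  carrier S := I.carrier S ⊔ J.carrier S
  map_mem f x hx := by
    obtain ⟨y, hy, z, hz, rfl⟩ := Submodule.mem_sup.1 hx
    rw [map_add]
    exact Submodule.add_mem_sup (I.map_mem f hy) (J.map_mem f hz)
  mul_mem a x hx := by
    obtain ⟨y, hy, z, hz, rfl⟩ := Submodule.mem_sup.1 hx
    rw [map_add]
    exact Submodule.add_mem_sup (I.mul_mem a hy) (J.mul_mem a hz)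

/-- On expanding a product of sums, every term but the one with all factors from `I` lies in `J`. -/
theorem IsPowerProduct.decompose {I J : IdealObj A} {n : ℕ} {S : NormedSet.{u}} {x : A.pts S}
    (h : IsPowerProduct (I.sum J) n S x) :
    ∃ y z, IsPowerProduct I n S y ∧ z ∈ J.carrier S ∧ x = y + z := by
  induction h with
  | base h =>
    obtain ⟨y, hy, z, hz, rfl⟩ := Submodule.mem_sup.1 h
    exact ⟨y, z, .base hy, hz, rfl⟩
  | step _ h ih =>
    obtain ⟨y, z, hy, hz, rfl⟩ := ih
    obtain ⟨y', hy', z', hz', rfl⟩ := Submodule.mem_sup.1 h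
    refine ⟨A.mul y y', A.mul y z' + A.mul z (y' + z'), .step hy hy',
      Submodule.add_mem _ (J.mul_mem y hz') (J.mul_mem_right hz _), ?_⟩
    simp only [map_add, LinearMap.add_apply]
    abel

/-- Index `n` stands for `n + 1` factors, so $(a + 1) + (b + 1)$ factors have index `a + b + 1`. The
map `f` records the change of bracketing, since products live over iterated tensor products. -/
theorem IsPowerProduct.split {I : IdealObj A} {a : ℕ} : ∀ {b : ℕ} {S : NormedSet.{u}} {x : A.pts S},
    IsPowerProduct I (a + b + 1) S x → ∃ (T T' : NormedSet.{u}) (y : A.pts T) (z : A.pts T')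
      (f : BoundedHom (S.free k H) ((T.tensor T').free k H)), IsPowerProduct I a T y ∧
        IsPowerProduct I b T' z ∧ x = A.map f (A.mul y z)
  | 0, _, _, .step hx hy => ⟨_, _, _, _, BoundedHom.id _, hx, .base hy, (A.map_id _ _).symm⟩
  | b + 1, _, _, .step (T := U) (y := w) hx hw => by
    obtain ⟨T, T', y, z, f, hy, hz, rfl⟩ := split hx
    have h := A.mul_natural f (BoundedHom.id (U.free k H)) (A.mul y z) w
    rw [A.map_id, A.mul_assoc, ← A.map_comp] at h
    exact ⟨_, _, _, _, _, hy, .step hz hw, h⟩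

/-- A high power of $I + J$ lies in $J$ because $I$ is nilpotent; powers of that power lie in powers
of $J$ and eventually vanish. -/
theorem IsNilpotent.sum {I J : IdealObj A} (hI : I.IsNilpotent) (hJ : J.IsNilpotent) :
    (I.sum J).IsNilpotent := by
  obtain ⟨m, hm⟩ := hI
  obtain ⟨n, hn⟩ := hJ
  have hmem : ∀ {S : NormedSet.{u}} {x : A.pts S}, IsPowerProduct (I.sum J) m S x →
      x ∈ J.carrier S := by
    intro S x hx
    obtain ⟨y, z, hy, hz, rfl⟩ := hx.decompose
    rw [hm S y hy, zero_add]
    exact hz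
  have key : ∀ l : ℕ, ∃ N : ℕ, ∀ (S : NormedSet.{u}) (x : A.pts S),
      IsPowerProduct (I.sum J) N S x → ∃ (T : NormedSet.{u}) (y : A.pts T)
        (f : BoundedHom (S.free k H) (T.free k H)), IsPowerProduct J l T y ∧ x = A.map f y := by
    intro l
    induction l with
    | zero => exact ⟨m, fun S x hx => ⟨S, x, BoundedHom.id _, .base (hmem hx), (A.map_id S x).symm⟩⟩
    | succ l ih =>
      obtain ⟨N, hN⟩ := ih
      -- Of the `N + m + 2` factors, the first `N + 1` give a product of index `l` from `J` by
      -- induction, and the last `m + 1` give one more element of `J`.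
      refine ⟨N + m + 1, fun S x hx => ?_⟩
      obtain ⟨T, T', y, z, f, hy, hz, rfl⟩ := hx.split
      obtain ⟨U, y, g, hy', rfl⟩ := hN T y hy
      have h := A.mul_natural g (BoundedHom.id (T'.free k H)) y z
      rw [A.map_id] at h
      rw [h, ← A.map_comp]
      exact ⟨_, _, _, .step hy' (hmem hz), rfl⟩
  obtain ⟨N, hN⟩ := key n
  refine ⟨N, fun S x hx => ?_⟩
  obtain ⟨T, y, f, hy, rfl⟩ := hN S x hx
  rw [hn T y hy, map_zero]

theorem sum_isSmall {I J : IdealObj A} (hI : I.toSub.IsSmall) (hJ : J.toSub.IsSmall) :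
    (I.sum J).toSub.IsSmall := by
  obtain ⟨ι, S, x, hx, hmin⟩ := hI
  obtain ⟨ι', S', y, hy, hmin'⟩ := hJ
  refine ⟨ι ⊕ ι', Sum.elim S S', fun i => match i with | .inl i => x i | .inr i => y i, ?_, ?_⟩
  · rintro (i | i)
    · exact (le_sup_left : I.carrier (S i) ≤ I.carrier (S i) ⊔ J.carrier (S i)) (hx i)
    · exact (le_sup_right : J.carrier (S' i) ≤ I.carrier (S' i) ⊔ J.carrier (S' i)) (hy i)
  · exact fun N' hN' T => sup_le (hmin N' (fun i => hN' (.inl i)) T)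
      (hmin' N' (fun i => hN' (.inr i)) T)

end IdealObj

/-- This makes colimits over all nilpotent ideals filtered, so that equality in them is detected at
a single ideal. -/
instance (P : HeartRing k H) : IsDirectedOrder P.NilpotentIdeal where
  directed I J := ⟨⟨I.ideal.sum J.ideal, I.nilpotent.sum J.nilpotent,
    IdealObj.sum_isSmall I.small J.small⟩, fun S => (le_sup_left : I.ideal.carrier S ≤ _),
      fun S => (le_sup_right : J.ideal.carrier S ≤ _)⟩

instance (P : HeartRing k H) : Nonempty P.NilpotentIdeal := ⟨NilpotentIdeal.zero P⟩

theorem NilpotentIdeal.zero_le {P : HeartRing k H} (I : P.NilpotentIdeal) :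
    NilpotentIdeal.zero P ≤ I :=
  (bot_le : (⊥ : IdealObj P) ≤ I.ideal)

/-- The divided powers of $0$ are the same in every structure: $\gamma_0(0) = 1$ and $\gamma_n(0) =
0$ for $n > 0$. -/
theorem PDIdeal.zero_le {P : HeartRing k H} (I : P.PDIdeal) : PDIdeal.zero P ≤ I := by
  refine ⟨NilpotentIdeal.zero_le I.ideal, fun n x hx => ?_⟩
  classical
  obtain rfl : x = 0 := hx
  refine Eq.trans ?_ (dividedPowersBot_dpow_eq n (0 : P.Sections)).symm
  rcases eq_or_ne n 0 with rfl | hn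
  · rw [if_pos ⟨rfl, rfl⟩]
    exact I.pd.dpow_zero (Ideal.zero_mem _)
  · rw [if_neg fun h => hn h.2]
    exact I.pd.dpow_eval_zero hn

end HeartRing

/-! ### The algebras $\pi_0(R)/I$ as admissible test objects. -/

namespace SimplicialRing

/-- It is the image of $R_1$ under $d_0 - d_1$, and objects of the left heart are small. -/
theorem boundaryIdeal_isSmall {κ : IndKind} {R : SimplicialRing k H} (hR : R.InLeftHeart κ) :
    R.boundaryIdeal.toSub.IsSmall := by
  let f : HeartModule.Hom (R.level 1).toHeartModule (R.level 0).toHeartModule :=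
    { app := fun S => HeartRing.app (R.δ (n := 0) 0) S - HeartRing.app (R.δ (n := 0) 1) S
      naturality := fun u x => by
        rw [LinearMap.sub_apply, LinearMap.sub_apply, map_sub, HeartRing.app_map,
          HeartRing.app_map] }
  exact (hR 1).isSmall_top.of_le_image f
    (HeartModule.Sub.ext (funext fun S => (Submodule.map_top _).symm))

theorem piZero_inLeftHeart {κ : IndKind} {R : SimplicialRing k H} (hR : R.InLeftHeart κ) :
    R.piZero.toHeartModule.InLeftHeart κ :=
  HeartRing.quot_inLeftHeart _ _ (hR 0) (boundaryIdeal_isSmall hR)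

/-- Needed in order to apply the étale hypothesis to $\pi_0(R)/I$ in place of $R$. -/
theorem nilpotentQuotients_inLeftHeart {κ : IndKind} {R : SimplicialRing k H}
    (hR : R.InLeftHeart κ) (I : R.piZero.NilpotentIdeal) :
    (R.nilpotentQuotients.obj I).InLeftHeart κ := fun _ =>
  HeartRing.quot_inLeftHeart _ _ (piZero_inLeftHeart hR) I.small

end SimplicialRing

end AnalyticStack

namespace AnalyticStack

variable {k : BanachKind} {H : Type u} [NormedCommRing H] [BanachBase k H]

/-! ### Composition of affinoid algebras. -/

namespace HeartRing

theorem mul_map_right (A : HeartRing k H) {S T U : NormedSet.{u}} (x : A.pts S)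
    (g : BoundedHom (T.free k H) (U.free k H)) (y : A.pts U) :
    A.mul x (A.map g y) =
      A.map (NormedSet.tensorHom (BoundedHom.id (S.free k H)) g) (A.mul x y) := by
  rw [← A.mul_natural, A.map_id]

theorem mul_map_left (A : HeartRing k H) {S T U : NormedSet.{u}}
    (g : BoundedHom (T.free k H) (U.free k H)) (x : A.pts U) (y : A.pts S) :
    A.mul (A.map g x) y =
      A.map (NormedSet.tensorHom g (BoundedHom.id (S.free k H))) (A.mul x y) := by
  rw [← A.mul_natural, A.map_id]

theorem map_eq_self (A : HeartRing k H) {S : NormedSet.{u}}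
    {f : BoundedHom (S.free k H) (S.free k H)} (hf : ∀ s, f.1 (S.basis s) = S.basis s)
    (x : A.pts S) : A.map f x = x := by
  have e : f = BoundedHom.id _ := NormedSet.hom_ext hf
  rw [e, A.map_id]

theorem mul_assoc_symm (A : HeartRing k H) {S T U : NormedSet.{u}} (x : A.pts S) (y : A.pts T)
    (z : A.pts U) : A.mul x (A.mul y z) = A.map (NormedSet.push k H (S := S.tensor (T.tensor U))
      (T := (S.tensor T).tensor U) (fun p => ((p.1, p.2.1), p.2.2))
      fun _ => (_root_.mul_assoc _ _ _).le) (A.mul (A.mul x y) z) := by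
  rw [A.mul_assoc, ← A.map_comp]
  refine (A.map_eq_self (fun s => ?_) _).symm
  rw [BoundedHom.comp_apply, NormedSet.push_basis, NormedSet.push_basis]

/-- The interchange of the two middle factors. -/
theorem mul_mul_mul_comm (A : HeartRing k H) {S T U V : NormedSet.{u}} (x : A.pts S) (y : A.pts T)
    (z : A.pts U) (t : A.pts V) : A.mul (A.mul x y) (A.mul z t) =
      A.map (NormedSet.push k H (S := (S.tensor T).tensor (U.tensor V))
        (T := (S.tensor U).tensor (T.tensor V)) (fun p => ((p.1.1, p.2.1), (p.1.2, p.2.2)))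
        fun _ => (_root_.mul_mul_mul_comm _ _ _ _).le) (A.mul (A.mul x z) (A.mul y t)) := by
  rw [A.mul_assoc x y, A.mul_assoc_symm y z t, A.mul_comm z y, A.mul_map_left, A.mul_assoc z y t,
    ← A.map_comp, ← A.map_comp, A.mul_map_right, A.mul_assoc_symm x z, ← A.map_comp, ← A.map_comp]
  congr 2
  refine NormedSet.hom_ext fun s => ?_
  simp only [BoundedHom.comp_apply, NormedSet.push_basis, NormedSet.tensorHom_basis,
    BoundedHom.id_apply, NormedSet.pureTensor_basis]
  rfl

/-- The splitting of a monomial in `d + e` variables. -/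
def splitMonomial (d e : ℕ) (m : (NormedSet.monomials.{u} (d + e)).carrier) :
    ((NormedSet.monomials.{u} d).tensor (NormedSet.monomials e)).carrier :=
  (⟨fun i => m.down (Fin.castAdd e i)⟩, ⟨fun i => m.down (Fin.natAdd d i)⟩)

def joinMonomial (d e : ℕ) (m : ((NormedSet.monomials.{u} d).tensor (NormedSet.monomials e)).carrier) :
    (NormedSet.monomials.{u} (d + e)).carrier :=
  ⟨Fin.append m.1.down m.2.down⟩

theorem splitMonomial_joinMonomial (d e : ℕ)
    (m : ((NormedSet.monomials.{u} d).tensor (NormedSet.monomials e)).carrier) :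
    splitMonomial d e (joinMonomial d e m) = m := by
  refine Prod.ext (ULift.ext _ _ (funext fun i => ?_)) (ULift.ext _ _ (funext fun i => ?_))
  · exact Fin.append_left _ _ i
  · exact Fin.append_right _ _ i

variable (k H) in
noncomputable def splitHom (d e : ℕ) : BoundedHom ((NormedSet.monomials.{u} (d + e)).free k H)
    (((NormedSet.monomials.{u} d).tensor (NormedSet.monomials e)).free k H) :=
  NormedSet.push k H (splitMonomial d e) fun _ => (_root_.mul_one (1 : ℝ)).le

variable (k H) in
noncomputable def joinHom (d e : ℕ) :
    BoundedHom (((NormedSet.monomials.{u} d).tensor (NormedSet.monomials e)).free k H)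
      ((NormedSet.monomials.{u} (d + e)).free k H) :=
  NormedSet.push k H (joinMonomial d e) fun _ => (_root_.mul_one (1 : ℝ)).ge

theorem splitHom_basis (d e : ℕ) (m : (NormedSet.monomials.{u} (d + e)).carrier) :
    (splitHom k H d e).1 (NormedSet.basis _ m) = NormedSet.basis _ (splitMonomial d e m) :=
  NormedSet.push_basis (S := NormedSet.monomials.{u} (d + e)) _ _ m

theorem joinHom_basis (d e : ℕ)
    (m : ((NormedSet.monomials.{u} d).tensor (NormedSet.monomials e)).carrier) :
    (joinHom k H d e).1 (NormedSet.basis _ m) = NormedSet.basis _ (joinMonomial d e m) :=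
  NormedSet.push_basis (S := (NormedSet.monomials.{u} d).tensor (NormedSet.monomials e)) _ _ m

/-- The product of two monomial systems can thus be recovered from the concatenated system. -/
theorem map_joinHom_splitHom (A : HeartRing k H) (d e : ℕ)
    (x : A.pts ((NormedSet.monomials.{u} d).tensor (NormedSet.monomials e))) :
    A.map (joinHom k H d e) (A.map (splitHom k H d e) x) = x := by
  rw [← A.map_comp]
  refine A.map_eq_self (fun s => ?_) x
  rw [BoundedHom.comp_apply, joinHom_basis, splitHom_basis, splitMonomial_joinMonomial]

theorem IsMonomialSystem.app {A B : HeartRing k H} (φ : A ⟶ B) {d : ℕ}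
    {x : A.pts (NormedSet.monomials d)} (hx : A.IsMonomialSystem d x) :
    B.IsMonomialSystem d (app φ _ x) where
  one := by
    rw [← app_map, hx.one]
    exact Hom.map_one φ
  mul := by rw [← app_map, hx.mul, app_mul]

/-- This is the map from $H\langle X, Y\rangle = H\langle X\rangle \otimes H\langle Y\rangle$
induced by two algebra maps. It is multiplicative because the middle factors of $(xy)(xy)$ may be
interchanged; the remaining identities of maps of free modules are checked on basis vectors. -/
theorem IsMonomialSystem.append {A : HeartRing k H} {d e : ℕ}
    {x : A.pts (NormedSet.monomials d)} {y : A.pts (NormedSet.monomials e)}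
    (hx : A.IsMonomialSystem d x) (hy : A.IsMonomialSystem e y) :
    A.IsMonomialSystem (d + e) (A.map (splitHom k H d e) (A.mul x y)) where
  one := by
    have h := congrArg₂ (fun a b => A.map (diag k H) (A.mul a b)) hx.one hy.one
    replace h := h.trans (A.one_sectionMul A.one)
    rw [A.mul_natural, ← A.map_comp] at h
    rw [← A.map_comp]
    refine Eq.trans ?_ h
    congr 2
    refine NormedSet.hom_ext fun s => ?_
    rw [BoundedHom.comp_apply, BoundedHom.comp_apply, diag_basis, NormedSet.tensorHom_basis,
      NormedSet.push_basis, NormedSet.push_basis, NormedSet.push_basis, NormedSet.pureTensor_basis,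
      splitHom_basis]
    rfl
  mul := by
    rw [A.mul_natural, A.mul_mul_mul_comm, ← hx.mul, ← hy.mul, A.mul_natural, ← A.map_comp,
      ← A.map_comp, ← A.map_comp]
    congr 2
    refine NormedSet.hom_ext fun s => ?_
    rw [BoundedHom.comp_apply, BoundedHom.comp_apply, BoundedHom.comp_apply,
      NormedSet.tensorHom_basis, NormedSet.push_basis, splitHom_basis, splitHom_basis,
      splitHom_basis, NormedSet.pureTensor_basis, NormedSet.push_basis, NormedSet.tensorHom_basis,
      NormedSet.push_basis, NormedSet.push_basis, NormedSet.pureTensor_basis]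
    rfl

/-- For a subobject $N$ of $C$ containing the products of scalars from $A$ with the concatenated
system, the $b$ with $\psi(b) y \in N$ form a subobject of $B$. It contains all $\varphi(a) x$,
hence is $B$; then $N$ contains all $\psi(b) y$, hence is $C$. -/
theorem IsAffinoid.comp {A B C : HeartRing k H} {φ : A ⟶ B} {ψ : B ⟶ C} (hφ : IsAffinoid φ)
    (hψ : IsAffinoid ψ) : IsAffinoid (φ ≫ ψ) := by
  obtain ⟨d, x, hx, hx'⟩ := hφ
  obtain ⟨e, y, hy, hy'⟩ := hψ
  refine ⟨d + e, _, (hx.app ψ).append hy, fun N hN => hy' N fun S b => ?_⟩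
  let N' : HeartModule.Sub B.toHeartModule :=
    { carrier := fun S => (N.carrier (S.tensor (NormedSet.monomials e))).comap
        ((C.mul.flip y).comp (HeartRing.app ψ S))
      map_mem := fun {S T} f b hb => by
        change C.mul (HeartRing.app ψ _ (B.map f b)) y ∈ N.carrier _
        rw [app_map, mul_map_left]
        exact N.map_mem _ hb }
  refine hx' N' (fun S a => ?_) S b
  change C.mul (HeartRing.app ψ _ (B.mul (HeartRing.app φ S a) x)) y ∈ N.carrier _
  rw [app_mul, C.mul_assoc, ← C.map_joinHom_splitHom d e (C.mul (HeartRing.app ψ _ x) y),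
    mul_map_right]
  exact N.map_mem _ (N.map_mem _ (hN S a))

/-- Restriction of scalars. -/
def ModuleObj.restrict {P Q : HeartRing k H} (ρ : P ⟶ Q) (N : Q.ModuleObj) : P.ModuleObj where
  toHeartModule := N.toHeartModule
  act := N.act.comp (app ρ _)
  act_natural f g a m := by
    change N.act (app ρ _ (P.map f a)) _ = _
    rw [app_map]
    exact N.act_natural f g _ m
  mul_act a b m := by
    change N.act (app ρ _ (P.mul a b)) m = _
    rw [app_mul]
    exact N.mul_act _ _ m
  one_act m := by
    have h : app ρ _ P.one = Q.one := Hom.map_one ρ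
    change N.act (app ρ _ P.one) m = _
    rw [h]
    exact N.one_act m

end HeartRing

/-! ### Transitivity of base change for homotopy modules. -/

namespace SimplicialRing

theorem piZeroMap_comp {A B C : SimplicialRing k H} (φ : A ⟶ B) (ψ : B ⟶ C) :
    piZeroMap (φ ≫ ψ) = piZeroMap φ ≫ piZeroMap ψ := by
  refine HeartRing.Hom.ext (funext fun S => LinearMap.ext fun x => ?_)
  obtain ⟨x, rfl⟩ := Submodule.mkQ_surjective _ x
  rfl

/-- The map of homotopy modules. -/
noncomputable def homotopyMap {A B : SimplicialRing k H} (φ : A ⟶ B) (n : ℕ) :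
    HeartModule.Hom (A.homotopy n) (B.homotopy n) where
  app S := Submodule.mapQ _ _
    { toFun := cyclesMap φ
      map_add' := fun x y => Subtype.ext (map_add _ x.1 y.1)
      map_smul' := fun c x => Subtype.ext (map_smul _ c x.1) } (by
    rintro z ⟨x, hx, e⟩
    have hx' : x ∈ (A.faceKer n fun i => i ≠ 0).carrier S := hx
    refine ⟨HeartRing.app (φ.app (op (SimplexCategory.mk (n + 1)))) S x, ?_, ?_⟩
    · change _ ∈ (B.faceKer n fun i => i ≠ 0).carrier S
      simp only [faceKer, Submodule.mem_iInf, LinearMap.mem_ker] at hx' ⊢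
      intro i hi
      refine (level_map_comm φ (SimplexCategory.δ i) S x).symm.trans ?_
      exact (congrArg _ (hx' i hi)).trans (map_zero _)
    · exact (level_map_comm φ (SimplexCategory.δ 0) S x).symm.trans (congrArg _ e))
  naturality f x := by
    obtain ⟨x, rfl⟩ := Submodule.mkQ_surjective _ x
    exact congrArg (Submodule.mkQ _) (Subtype.ext (HeartRing.app_map _ f x.1))

theorem homotopyMap_cyclesSmul {A B : SimplicialRing k H} (φ : A ⟶ B) {n : ℕ} {S T : NormedSet.{u}}
    (a : (A.level 0).pts S) (z : (A.cycles n).carrier T) :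
    (homotopyMap φ n).app _ (A.cycleClass (A.cyclesSmul a z)) =
      B.cycleClass (B.cyclesSmul (HeartRing.app (φ.app (op (SimplexCategory.mk 0))) S a)
        (cyclesMap φ z)) := by
  refine congrArg (Submodule.mkQ _) (Subtype.ext ?_)
  refine (HeartRing.app_mul _ _ _).trans ?_
  exact congrArg (fun t => (B.level n).mul t _) (level_map_comm φ _ S a)

/-- A linear map on $\pi_n(A)$ is extended to $\pi_n(B)$, with the target restricted to $\pi_0(B)$,
and then to $\pi_n(C)$. -/
theorem HomotopyBaseChange.comp {A B C : SimplicialRing k H} {φ : A ⟶ B} {ψ : B ⟶ C}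
    (hφ : HomotopyBaseChange φ) (hψ : HomotopyBaseChange ψ) : HomotopyBaseChange (φ ≫ ψ) := by
  intro n N h hh
  obtain ⟨h₁, ⟨hl₁, he₁⟩, hu₁⟩ := hφ n (N.restrict (piZeroMap ψ)) h fun a z => hh a z
  obtain ⟨h₂, ⟨hl₂, he₂⟩, hu₂⟩ := hψ n N h₁ fun a z => hl₁ a z
  refine ⟨h₂, ⟨hl₂, fun S z => (he₂ S (cyclesMap φ z)).trans (he₁ S z)⟩, ?_⟩
  rintro h' ⟨hl, he⟩
  refine hu₂ h' ⟨hl, fun S z => ?_⟩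
  -- A competing extension restricts to a $\pi_0(B)$-linear map on $\pi_n(B)$, which uniqueness in
  -- the first stage identifies with `h₁`.
  have e : h'.comp (homotopyMap ψ n) = h₁ := by
    refine hu₁ _ ⟨fun a z => ?_, fun S z => he S z⟩
    change h'.app _ ((homotopyMap ψ n).app _ _) = _
    rw [homotopyMap_cyclesSmul]
    exact hl _ _
  exact congrArg (fun t => HeartModule.Hom.app t S (B.cycleClass z)) e

theorem IsAffinoid.comp {A B C : SimplicialRing k H} {φ : A ⟶ B} {ψ : B ⟶ C}
    (hφ : IsAffinoid φ) (hψ : IsAffinoid ψ) : IsAffinoid (φ ≫ ψ) :=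
  ⟨by rw [piZeroMap_comp]; exact hφ.1.comp hψ.1, hφ.2.comp hψ.2⟩

end SimplicialRing

end AnalyticStack

namespace AnalyticStack

variable {k : BanachKind} {H : Type u} [NormedCommRing H] [BanachBase k H]

namespace HeartRing

/-- The map of quotients given by a surjection and the image of an ideal. -/
noncomputable def quotImage {A A' : HeartRing k H} (f : A ⟶ A')
    (hf : ∀ S, Function.Surjective (app f S)) (I : IdealObj A) :
    A.quot I ⟶ A'.quot (I.image f hf) where
  app S := Submodule.mapQ _ _ (app f S) fun x hx => ⟨x, hx, rfl⟩
  naturality u x := by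
    obtain ⟨x, rfl⟩ := Submodule.mkQ_surjective _ x
    exact congrArg (Submodule.mkQ _) (app_map f u x)
  map_one := congrArg (Submodule.mkQ _) (Hom.map_one f)
  map_mul x y := by
    obtain ⟨x, rfl⟩ := Submodule.mkQ_surjective _ x
    obtain ⟨y, rfl⟩ := Submodule.mkQ_surjective _ y
    exact congrArg (Submodule.mkQ _) (app_mul f x y)

end HeartRing

/-! ### Components, reductions and unique lifting. -/

namespace SimplicialRing

open CategoryTheory.Limits

/-- Nilpotent ideals `K ≥ I` give nilpotent ideals of `π₀` of the discrete algebra `π₀(R)/I`, and the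
reduction modulo the latter factors through `π₀(R)/K`. -/
theorem exists_factor_toNilpotentQuotients (R : SimplicialRing k H)
    {I K : R.piZero.NilpotentIdeal} (h : I ⟶ K) :
    ∃ (K' : (R.nilpotentQuotients.obj I).piZero.NilpotentIdeal)
      (m : R.nilpotentQuotients.obj K ⟶ (R.nilpotentQuotients.obj I).nilpotentQuotients.obj K'),
      R.nilpotentQuotients.map h ≫ m = (R.nilpotentQuotients.obj I).toNilpotentQuotients.app K' := by
  -- The $\pi_0$ of the constant object is again a quotient, by its zero boundary ideal, and so only
  -- isomorphic to $\pi_0(R)/I$; `K` is transported along the composite projection.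
  let f : R.piZero ⟶ (R.nilpotentQuotients.obj I).piZero :=
    R.piZero.mkQuot I.ideal ≫ (R.nilpotentQuotients.obj I).toPiZero
  have hf : ∀ S, Function.Surjective (HeartRing.app f S) := fun S =>
    (Submodule.mkQ_surjective _).comp (Submodule.mkQ_surjective _)
  refine ⟨⟨K.ideal.image f hf, K.nilpotent.image, K.small.image _⟩,
    (SimplicialObject.const (HeartRing k H)).map (HeartRing.quotImage f hf K.ideal), ?_⟩
  ext n
  refine HeartRing.Hom.ext (funext fun S => LinearMap.ext fun x => ?_)
  obtain ⟨x, rfl⟩ := Submodule.mkQ_surjective _ x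
  rfl

/-- The components of the points of `Spec B` with values in `R`. -/
noncomputable abbrev pi (B R : SimplicialRing k H) : Type (u + 1) := SSet.π₀ ((spec B).obj R)

/-- Functoriality in the algebra of values. -/
noncomputable def pi.map (B : SimplicialRing k H) {R R' : SimplicialRing k H} (r : R ⟶ R') :
    pi B R → pi B R' :=
  SSet.mapπ₀ ((spec B).map r)

/-- Composition with `Spec φ`. -/
noncomputable def pi.comap {A B : SimplicialRing k H} (φ : A ⟶ B) (R : SimplicialRing k H) :
    pi B R → pi A R :=
  SSet.mapπ₀ ((specMap φ).app R)

/-- Reduction modulo a nilpotent ideal. -/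
noncomputable def pi.red (B : SimplicialRing k H) {R : SimplicialRing k H}
    (I : R.piZero.NilpotentIdeal) : pi B R → pi B (R.nilpotentQuotients.obj I) :=
  pi.map B (R.toNilpotentQuotients.app I)

theorem pi.map_comp (B : SimplicialRing k H) {R R' R'' : SimplicialRing k H} (r : R ⟶ R')
    (s : R' ⟶ R'') (x : pi B R) : pi.map B (r ≫ s) x = pi.map B s (pi.map B r x) := by
  rw [pi.map, Functor.map_comp, SSet.mapπ₀_comp_apply]
  rfl

theorem pi.comap_map {A B : SimplicialRing k H} (φ : A ⟶ B) {R R' : SimplicialRing k H}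
    (r : R ⟶ R') (x : pi B R) :
    pi.comap φ R' (pi.map B r x) = pi.map A r (pi.comap φ R x) := by
  rw [pi.comap, pi.map, ← SSet.mapπ₀_comp_apply, (specMap φ).naturality, SSet.mapπ₀_comp_apply]
  rfl

theorem pi.comap_red {A B : SimplicialRing k H} (φ : A ⟶ B) {R : SimplicialRing k H}
    (I : R.piZero.NilpotentIdeal) (x : pi B R) :
    pi.comap φ _ (pi.red B I x) = pi.red A I (pi.comap φ R x) :=
  pi.comap_map φ _ x

theorem pi.comap_comp {A B C : SimplicialRing k H} (φ : A ⟶ B) (ψ : B ⟶ C)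
    (R : SimplicialRing k H) (x : pi C R) :
    pi.comap (φ ≫ ψ) R x = pi.comap φ R (pi.comap ψ R x) := by
  have e : specMap (φ ≫ ψ) = specMap ψ ≫ specMap φ := by
    rw [specMap, op_comp, Functor.map_comp]
    rfl
  rw [pi.comap, e, NatTrans.comp_app, SSet.mapπ₀_comp_apply]
  rfl

theorem pi.map_red (B : SimplicialRing k H) {R : SimplicialRing k H}
    {I K : R.piZero.NilpotentIdeal} (h : I ⟶ K) (x : pi B R) :
    pi.map B (R.nilpotentQuotients.map h) (pi.red B I x) = pi.red B K x := by
  rw [pi.red, ← pi.map_comp, ← R.toNilpotentQuotients.naturality h]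
  exact congrArg (fun t => pi.map B t x) (Category.id_comp _)

/-- Unique lifting of components along nilpotent ideals. -/
def HasUniqueLifting {A B : SimplicialRing k H} (φ : A ⟶ B) (R : SimplicialRing k H) : Prop :=
  ∀ (I : R.piZero.NilpotentIdeal) (x : pi B (R.nilpotentQuotients.obj I)) (z : pi A R),
    pi.comap φ _ x = pi.red A I z → ∃! y : pi B R, pi.red B I y = x ∧ pi.comap φ R y = z

/-- The component over $A$ is lifted to $B$, then to $C$. For uniqueness, the image over $B$ of
another lift solves the first lifting problem, so it equals `y`. -/
theorem HasUniqueLifting.comp {A B C : SimplicialRing k H} {φ : A ⟶ B} {ψ : B ⟶ C}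
    {R : SimplicialRing k H} (hφ : HasUniqueLifting φ R) (hψ : HasUniqueLifting ψ R) :
    HasUniqueLifting (φ ≫ ψ) R := by
  intro I x z h
  rw [pi.comap_comp] at h
  obtain ⟨y, ⟨hy₁, hy₂⟩, hy⟩ := hφ I _ z h
  obtain ⟨w, ⟨hw₁, hw₂⟩, hw⟩ := hψ I x y hy₁.symm
  refine ⟨w, ⟨hw₁, by rw [pi.comap_comp, hw₂, hy₂]⟩, ?_⟩
  rintro w' ⟨h₁, h₂⟩
  rw [pi.comap_comp] at h₂
  exact hw w' ⟨h₁, hy _ ⟨by rw [← pi.comap_red, h₁], h₂⟩⟩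

/-! ### Components of the completions. -/

section Completion

variable {A B : SimplicialRing k H} (φ : A ⟶ B) (R : SimplicialRing k H)
  {J : Type (u + 1)} [SmallCategory J] (F : J ⥤ R.piZero.NilpotentIdeal)

/-- The projection from the completion diagram to `X(π₀(R)/I)`. -/
noncomputable def completionFst :
    completionDiagram φ R F ⟶ (F ⋙ R.nilpotentQuotients) ⋙ spec B :=
  homotopyPullbackFst (Functor.whiskerLeft (F ⋙ R.nilpotentQuotients) (specMap φ))
    (toReductions A R F)

/-- The projection from the completion diagram to `Y(R)`. -/
noncomputable def completionSnd :
    completionDiagram φ R F ⟶ (Functor.const J).obj ((spec A).obj R) :=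
  homotopyPullbackSnd (Functor.whiskerLeft (F ⋙ R.nilpotentQuotients) (specMap φ))
    (toReductions A R F)

theorem toCompletionDiagram_fst :
    toCompletionDiagram φ R F ≫ completionFst φ R F = toReductions B R F :=
  homotopyPullbackLift_fst _ _ _

theorem toCompletionDiagram_snd :
    toCompletionDiagram φ R F ≫ completionSnd φ R F =
      (Functor.const J).map ((specMap φ).app R) :=
  homotopyPullbackLift_snd _ _ _

noncomputable def diagramFst (j : J) (d : SSet.π₀ ((completionDiagram φ R F).obj j)) :
    pi B (R.nilpotentQuotients.obj (F.obj j)) :=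
  SSet.mapπ₀ ((completionFst φ R F).app j) d

noncomputable def diagramSnd (j : J) (d : SSet.π₀ ((completionDiagram φ R F).obj j)) : pi A R :=
  SSet.mapπ₀ ((completionSnd φ R F).app j) d

noncomputable def diagramMk (j : J) (x : pi B R) : SSet.π₀ ((completionDiagram φ R F).obj j) :=
  SSet.mapπ₀ ((toCompletionDiagram φ R F).app j) x

noncomputable def diagramι (j : J) (d : SSet.π₀ ((completionDiagram φ R F).obj j)) :
    SSet.π₀ (completion φ R F) :=
  SSet.mapπ₀ (colimit.ι (completionDiagram φ R F) j) d

variable {φ R F}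

theorem isDiscrete_reductions (C : SimplicialRing k H) (j : J) :
    IsDiscrete (((F ⋙ R.nilpotentQuotients) ⋙ spec C).obj j) :=
  spec_const_isDiscrete C _

/-- Components of a homotopy fibre product are not pairs of components in general; they are here
because both reductions are discrete. -/
theorem diagram_existsUnique (j : J) (x : pi B (R.nilpotentQuotients.obj (F.obj j))) (z : pi A R)
    (h : pi.comap φ _ x = pi.red A (F.obj j) z) :
    ∃! d, diagramFst φ R F j d = x ∧ diagramSnd φ R F j d = z :=
  homotopyPullback_piZero
    (p := Functor.whiskerLeft (F ⋙ R.nilpotentQuotients) (specMap φ)) (q := toReductions A R F)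
    (fun j => isDiscrete_reductions B j) (fun j => isDiscrete_reductions A j) j x z h

theorem diagram_condition (j : J) (d : SSet.π₀ ((completionDiagram φ R F).obj j)) :
    pi.comap φ _ (diagramFst φ R F j d) = pi.red A (F.obj j) (diagramSnd φ R F j d) :=
  homotopyPullback_piZero_condition (fun j => isDiscrete_reductions A j) j d

theorem diagram_ext {j : J} {d d' : SSet.π₀ ((completionDiagram φ R F).obj j)}
    (h₁ : diagramFst φ R F j d = diagramFst φ R F j d')
    (h₂ : diagramSnd φ R F j d = diagramSnd φ R F j d') : d = d' :=
  (diagram_existsUnique j _ _ (diagram_condition j d)).unique ⟨rfl, rfl⟩ ⟨h₁.symm, h₂.symm⟩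

theorem diagramFst_mk (j : J) (x : pi B R) :
    diagramFst φ R F j (diagramMk φ R F j x) = pi.red B (F.obj j) x := by
  rw [diagramFst, diagramMk, ← SSet.mapπ₀_comp_apply, ← NatTrans.comp_app,
    toCompletionDiagram_fst]
  rfl

theorem diagramSnd_mk (j : J) (x : pi B R) :
    diagramSnd φ R F j (diagramMk φ R F j x) = pi.comap φ R x := by
  rw [diagramSnd, diagramMk, ← SSet.mapπ₀_comp_apply, ← NatTrans.comp_app,
    toCompletionDiagram_snd]
  rfl

theorem mapπ₀_toCompletion (j : J) (x : pi B R) :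
    SSet.mapπ₀ (toCompletion φ R F j) x = diagramι φ R F j (diagramMk φ R F j x) :=
  SSet.mapπ₀_comp_apply _ _ _

/-- Hence the canonical map from the index $0$ may be read at whichever index a given class lives.
-/
theorem toCompletion_eq {i j : J} (e : i ⟶ j) : toCompletion φ R F i = toCompletion φ R F j := by
  have h := (toCompletionDiagram φ R F).naturality e
  refine (congrArg (fun t => (toCompletionDiagram φ R F).app i ≫ t)
    (colimit.w (completionDiagram φ R F) e)).symm.trans ?_
  refine (Category.assoc _ _ _).symm.trans
    (congrArg (fun t => t ≫ colimit.ι (completionDiagram φ R F) j) ?_)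
  exact h.symm.trans (Category.id_comp _)

theorem diagramι_surjective (c : SSet.π₀ (completion φ R F)) :
    ∃ j d, diagramι φ R F j d = c :=
  Types.jointly_surjective_of_isColimit (isColimitPiZero (completionDiagram φ R F)) c

/-- Equal components of the completion have the same component in `Y(R)`, and become equal modulo some
nilpotent ideal. -/
theorem diagramι_eq {i j : J} {d : SSet.π₀ ((completionDiagram φ R F).obj i)}
    {d' : SSet.π₀ ((completionDiagram φ R F).obj j)}
    (h : diagramι φ R F i d = diagramι φ R F j d') :
    diagramSnd φ R F i d = diagramSnd φ R F j d' ∧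
      ∃ (K : R.piZero.NilpotentIdeal) (f : F.obj i ⟶ K) (g : F.obj j ⟶ K),
        pi.map B (R.nilpotentQuotients.map f) (diagramFst φ R F i d) =
          pi.map B (R.nilpotentQuotients.map g) (diagramFst φ R F j d') := by
  let G : R.piZero.NilpotentIdeal ⥤ Type (u + 1) :=
    R.nilpotentQuotients ⋙ spec B ⋙ SSet.π₀Functor
  -- `J` need not be filtered, so equality in its colimit says nothing directly about a common
  -- index. Two cocones extract what is needed: this one goes to the filtered colimit over all
  -- nilpotent ideals, the next one to the components of $Y(R)$.
  let c₁ : Cocone (completionDiagram φ R F ⋙ SSet.π₀Functor) :=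
    { pt := colimit G
      ι := (Functor.whiskerRight (completionFst φ R F) SSet.π₀Functor : _ ⟶ F ⋙ G) ≫
        Functor.whiskerLeft F (colimit.cocone G).ι }
  let c₂ : Cocone (completionDiagram φ R F ⋙ SSet.π₀Functor) :=
    { pt := pi A R
      ι := Functor.whiskerRight (completionSnd φ R F) SSet.π₀Functor ≫
        (Functor.constComp J ((spec A).obj R) SSet.π₀Functor).hom }
  have hc := isColimitPiZero (completionDiagram φ R F)
  have fac : ∀ (c : Cocone (completionDiagram φ R F ⋙ SSet.π₀Functor)),
      c.ι.app i d = c.ι.app j d' := fun c =>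
    (ConcreteCategory.congr_hom (hc.fac c i) d).symm.trans
      ((congrArg (hc.desc c) h).trans (ConcreteCategory.congr_hom (hc.fac c j) d'))
  exact ⟨fac c₂, (Types.FilteredColimit.isColimit_eq_iff G (colimit.isColimit G)).1 (fac c₁)⟩

/-- Points with the same class agree in $Y(R)$ and modulo some `K`, so uniqueness of lifts along `K`
applies. A class at index `j` is a compatible pair, and its lift maps to it. The generality in `J`
serves both completions at once. -/
theorem HasUniqueLifting.bijective_toCompletion (h : HasUniqueLifting φ R) (i : J)
    (hi : ∀ j, Nonempty (i ⟶ j)) : Function.Bijective (SSet.mapπ₀ (toCompletion φ R F i)) := by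
  constructor
  · intro x x' e
    rw [mapπ₀_toCompletion, mapπ₀_toCompletion] at e
    obtain ⟨h₂, K, f, g, h₁⟩ := diagramι_eq e
    rw [diagramSnd_mk, diagramSnd_mk] at h₂
    rw [diagramFst_mk, diagramFst_mk, pi.map_red, pi.map_red] at h₁
    exact (h K _ _ (pi.comap_red φ K x)).unique ⟨rfl, rfl⟩ ⟨h₁.symm, h₂.symm⟩
  · intro c
    obtain ⟨j, d, rfl⟩ := diagramι_surjective c
    obtain ⟨x, ⟨hx₁, hx₂⟩, -⟩ := h _ _ _ (diagram_condition j d)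
    refine ⟨x, ?_⟩
    rw [toCompletion_eq (hi j).some, mapπ₀_toCompletion]
    exact congrArg _ (diagram_ext (by rw [diagramFst_mk, hx₁]) (by rw [diagramSnd_mk, hx₂]))

/-- Injectivity on components gives uniqueness of lifts. -/
theorem eq_of_injective_toCompletion {i j : J} (e : i ⟶ j)
    (h : Function.Injective (SSet.mapπ₀ (toCompletion φ R F i))) {x x' : pi B R}
    (h₁ : pi.red B (F.obj j) x = pi.red B (F.obj j) x') (h₂ : pi.comap φ R x = pi.comap φ R x') :
    x = x' := by
  refine h ?_
  rw [toCompletion_eq e, mapπ₀_toCompletion, mapπ₀_toCompletion]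
  exact congrArg _ (diagram_ext (by rw [diagramFst_mk, diagramFst_mk, h₁])
    (by rw [diagramSnd_mk, diagramSnd_mk, h₂]))

end Completion

/-- Surjectivity for `R` gives existence up to enlarging the ideal, injectivity for the algebra
$\pi_0(R)/I$ removes the enlargement, and injectivity for `R` gives uniqueness. -/
theorem hasUniqueLifting_of_bijective {κ : IndKind} {A B : SimplicialRing k H} {φ : A ⟶ B}
    (h : ∀ R : SimplicialRing k H, R.InLeftHeart κ →
      Function.Bijective (SSet.mapπ₀ (toFormalCompletion φ R)))
    {R : SimplicialRing k H} (hR : R.InLeftHeart κ) : HasUniqueLifting φ R := by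
  intro I x z hxz
  obtain ⟨d, ⟨hd₁, hd₂⟩, -⟩ := diagram_existsUnique (F := 𝟭 R.piZero.NilpotentIdeal) I x z hxz
  obtain ⟨y, hy⟩ := (h R hR).2 (diagramι φ R (𝟭 _) I d)
  rw [toFormalCompletion, mapπ₀_toCompletion] at hy
  obtain ⟨h₂, K, f, g, h₁⟩ := diagramι_eq hy
  rw [diagramSnd_mk, hd₂] at h₂
  rw [diagramFst_mk, hd₁] at h₁
  -- So far `y` and `x` agree only modulo `K`. Both sides are components of $X(\pi_0(R)/I)$ with the
  -- same image in $Y(\pi_0(R)/I)$, and they agree modulo the nilpotent ideal `K'` induced by `K`.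
  have hy₁ : pi.red B I y = x := by
    obtain ⟨K', m, hm⟩ := R.exists_factor_toNilpotentQuotients (I := I) (K := K) g
    refine eq_of_injective_toCompletion (φ := φ) (F := 𝟭 _) (homOfLE K'.zero_le)
      (h _ (nilpotentQuotients_inLeftHeart hR I)).1 ?_ ?_
    · have hm' : ∀ t : pi B (R.nilpotentQuotients.obj I),
          pi.red B K' t = pi.map B m (pi.map B (R.nilpotentQuotients.map g) t) := fun t => by
        rw [← pi.map_comp, hm]
        rfl
      refine (hm' _).trans (Eq.trans (congrArg _ ?_) (hm' _).symm)
      exact (pi.map_red B g y).trans ((pi.map_red B f y).symm.trans h₁)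
    · rw [hxz, pi.comap_red, h₂]
  refine ⟨y, ⟨hy₁, h₂⟩, ?_⟩
  rintro y' ⟨h₁', h₂'⟩
  exact eq_of_injective_toCompletion (F := 𝟭 _) (homOfLE I.zero_le) (h R hR).1
    (h₁'.trans hy₁.symm) (h₂'.trans h₂.symm)

end SimplicialRing

end AnalyticStack

theorem mainTheorem8 {κ : AnalyticStack.IndKind} {k : AnalyticStack.BanachKind}
    {H : Type u} [NormedCommRing H] [AnalyticStack.BanachBase k H]
    {X Y Z : AnalyticStack.AffineStack κ k H} (f : X ⟶ Y) (g : Y ⟶ Z)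
    (hf : AnalyticStack.AffineStack.IsDeRhamEtale f)
    (hg : AnalyticStack.AffineStack.IsDeRhamEtale g) :
    AnalyticStack.AffineStack.IsDeRhamEtale (f ≫ g) ∧
      AnalyticStack.AffineStack.IsPDEtale (f ≫ g) := by
  -- On algebras the order is reversed: the map for `g` comes first, then the one for `f`.
  have affinoid : AnalyticStack.SimplicialRing.IsAffinoid
      (AnalyticStack.AffineStack.ringMap (f ≫ g)) := hg.1.comp hf.1
  have lifting : ∀ R : AnalyticStack.SimplicialRing k H, R.InLeftHeart κ →
      AnalyticStack.SimplicialRing.HasUniqueLifting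
        (AnalyticStack.AffineStack.ringMap (f ≫ g)) R := fun R hR =>
    (AnalyticStack.SimplicialRing.hasUniqueLifting_of_bijective hg.2 hR).comp
      (AnalyticStack.SimplicialRing.hasUniqueLifting_of_bijective hf.2 hR)
  -- The same lifting property is evaluated over two index categories, in each of which the zero
  -- ideal is the least element.
  exact ⟨⟨affinoid, fun R hR => (lifting R hR).bijective_toCompletion _
      fun I => ⟨homOfLE I.zero_le⟩⟩,
    ⟨affinoid, fun R hR => (lifting R hR).bijective_toCompletion _
      fun I => ⟨homOfLE (AnalyticStack.HeartRing.PDIdeal.zero_le I)⟩⟩⟩
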